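/- A small double category $\mathbb{D}$ is a category object in $\mathbf{Cat}$ (the category of small categories): sets of objects, horizontal morphisms, vertical morphisms and squares, with categories $(\mathrm{Obj},\mathrm{Hor})$ and $(\mathrm{Ver},\mathrm{Sq})$ under horizontal composition and $(\mathrm{Obj},\mathrm{Ver})$ and $(\mathrm{Hor},\mathrm{Sq})$ under vertical composition, compatible with sources, targets and identities and satisfying the interchange law. Let $\mathbf{DblCat}$ be the category of small double categories and double functors. The horizontal nerve $N_h\colon\mathbf{DblCat}\to\mathbf{Cat}^{\Delta^{op}}$ sends $\mathbb{D}$ to the simplicial category whose $n$-th category $(N_h\mathbb{D})_n$ has as objects the functors $[n]\to(\mathrm{Obj}\,\mathbb{D},\mathrm{Hor}\,\mathbb{D})$, as morphisms the functors $[n]\to(\mathrm{Ver}\,\mathbb{D},\mathrm{Sq}\,\mathbb{D})$, and vertical composition. A functor $F\colon\mathbf{A}\to\mathbf{B}$ is an isofibration if for every isomorphism $g\colon b\cong Fa$ in $\mathbf{B}$ there is an isomorphism $f\colon a'\cong a$ in $\mathbf{A}$ with $Fa'=b$ and $Ff=g$. A (complete and cocomplete) model category is cofibrantly generated by sets of morphisms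 $I$ and $J$ if the domains of $I$ (resp. $J$) are small relative to the transfinite compositions of pushouts of elements of $I$ (resp. $J$), the fibrations are exactly the morphisms with the right lifting property with respect to $J$, and the acyclic fibrations are exactly the morphisms with the right lifting property with respect to $I$. **Theorem.** There is a cofibrantly generated model structure on $\mathbf{DblCat}$ such that a double functor $K$ is a weak equivalence (resp. fibration) if and only if $(N_hK)_n$ is an equivalence of categories (resp. an isofibration) for every $n\ge 0$. It is transferred along an adjunction $c_h\dashv N_h$, in the following sense. The functor $N_h$ has a left adjoint $c_h\colon\mathbf{Cat}^{\Delta^{op}}\to\mathbf{DblCat}$. The category $\mathbf{Cat}^{\Delta^{op}}$ has a model structure whose weak equivalences (resp. fibrations) are the levelwise equivalences of categories (resp. levelwise isofibrations), cofibrantly generated by the set $I$ of the morphisms $$\coprod_{\Delta^{op}([n],-)}f\colon\ \coprod_{\Delta^{op}([n],-)}\mathbf{A}\to\coprod_{\Delta^{op}([n],-)}\mathbf{B},\qquad n\ge 0,$$ with $f\colon\mathbf A\to\mathbf B$ one of $\emptyset\to\{1\}$, $\{0,1\}\to\{0\to1\}$, $\{0\rightrightarrows1\}\to\{0\to1\}$,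 and the set $J$ of the morphisms of this form with $f$ the inclusion $\{1\}\to\{0\cong1\}$. A double functor $K$ is a weak equivalence (resp. fibration) in $\mathbf{DblCat}$ if and only if $N_hK$ is one in $\mathbf{Cat}^{\Delta^{op}}$, and the model structure on $\mathbf{DblCat}$ is cofibrantly generated by $c_hI$ and $c_hJ$. -/

import Mathlib

open CategoryTheory Limits Opposite HomotopicalAlgebra

universe w v u

/-! ### Categories presented by a set of objects and a set of arrows -/

/-- A category with set of objects `O` and set of arrows `A`; `comp f g` is "first `f`, then `g`". -/
structure CatStr (O A : Type u) where
  src : A → O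
  tgt : A → O
  id : O → A
  comp : ∀ f g : A, tgt f = src g → A
  src_id : ∀ a, src (id a) = a
  tgt_id : ∀ a, tgt (id a) = a
  src_comp : ∀ f g h, src (comp f g h) = src f
  tgt_comp : ∀ f g h, tgt (comp f g h) = tgt g
  id_comp : ∀ f h, comp (id (src f)) f h = f
  comp_id : ∀ f h, comp f (id (tgt f)) h = f
  assoc : ∀ f g k (h₁ : tgt f = src g) (h₂ : tgt g = src k) h₃ h₄,
    comp (comp f g h₁) k h₃ = comp f (comp g k h₂) h₄

/-- The pair of functions `(fo, fa)` is a functor from `C` to `C'`. In `map_comp` the composability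
of the images is automatic, so quantifying over its proof `h'` is no restriction. -/
structure IsFunctor {O A O' A' : Type u} (C : CatStr O A) (C' : CatStr O' A')
    (fo : O → O') (fa : A → A') : Prop where
  map_src : ∀ f, C'.src (fa f) = fo (C.src f)
  map_tgt : ∀ f, C'.tgt (fa f) = fo (C.tgt f)
  map_id : ∀ a, fa (C.id a) = C'.id (fo a)
  map_comp : ∀ f g h h', fa (C.comp f g h) = C'.comp (fa f) (fa g) h'

namespace CatStr

variable {O A O' A' : Type u}

/-- The type of objects of `C`, which carries the category structure given by `C`. -/
def Carrier (_ : CatStr O A) : Type u := O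

theorem comp_congr (C : CatStr O A) {f f' g g' : A} (hf : f = f') (hg : g = g')
    (h : C.tgt f = C.src g) (h' : C.tgt f' = C.src g') : C.comp f g h = C.comp f' g' h' := by
  subst hf hg; rfl

instance (C : CatStr O A) : Category.{u} C.Carrier where
  Hom a b := {f : A // C.src f = a ∧ C.tgt f = b}
  id a := ⟨C.id a, C.src_id a, C.tgt_id a⟩
  comp f g := ⟨C.comp f.1 g.1 (f.2.2.trans g.2.1.symm),
    (C.src_comp _ _ _).trans f.2.1, (C.tgt_comp _ _ _).trans g.2.2⟩
  id_comp f := by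
    obtain ⟨f, rfl, h⟩ := f
    exact Subtype.ext (C.id_comp f _)
  comp_id f := by
    obtain ⟨f, h, rfl⟩ := f
    exact Subtype.ext (C.comp_id f _)
  assoc f g k := Subtype.ext (C.assoc _ _ _ _ _ _ _)

/-- The small category given by `C`. -/
def toCat (C : CatStr O A) : Cat.{u, u} := Cat.of C.Carrier

end CatStr

namespace IsFunctor

variable {O A O' A' O'' A'' : Type u} {C : CatStr O A} {C' : CatStr O' A'} {C'' : CatStr O'' A''}

theorem refl (C : CatStr O A) : IsFunctor C C _root_.id _root_.id :=
  ⟨fun _ => rfl, fun _ => rfl, fun _ => rfl, fun _ _ _ _ => rfl⟩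

theorem trans {fo : O → O'} {fa : A → A'} {go : O' → O''} {ga : A' → A''}
    (hf : IsFunctor C C' fo fa) (hg : IsFunctor C' C'' go ga) :
    IsFunctor C C'' (go ∘ fo) (ga ∘ fa) where
  map_src f := by simp [hg.map_src, hf.map_src]
  map_tgt f := by simp [hg.map_tgt, hf.map_tgt]
  map_id a := by simp [hg.map_id, hf.map_id]
  map_comp f g h h' := by
    have e : C'.tgt (fa f) = C'.src (fa g) := by rw [hf.map_tgt, hf.map_src, h]
    simp only [Function.comp_apply]
    rw [hf.map_comp f g h e, hg.map_comp _ _ e h']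

/-- The functor given by a pair of functions. -/
def toFunctor {fo : O → O'} {fa : A → A'} (hf : IsFunctor C C' fo fa) : C.Carrier ⥤ C'.Carrier where
  obj a := fo a
  map f := ⟨fa f.1, (hf.map_src _).trans (congrArg fo f.2.1),
    (hf.map_tgt _).trans (congrArg fo f.2.2)⟩
  map_id a := Subtype.ext (hf.map_id a)
  map_comp _ _ := Subtype.ext (hf.map_comp _ _ _ _)

end IsFunctor

/-! ### Double categories and double functors -/

/-- Small double categories: category objects in `Cat`, spelled out. The category of objects is
`ver = (Obj, Ver)`, the category of morphisms is `verSq = (Hor, Sq)` (vertical composition of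
squares), and source, target, unit and composition of the category object are the functors
`(hor.src, horSq.src)`, `(hor.tgt, horSq.tgt)`, `(hor.id, horSq.id)`, `(hor.comp, horSq.comp)`. For
a square `α`: `verSq.src α` is its top, `verSq.tgt α` its bottom, `horSq.src α` its left side and
`horSq.tgt α` its right side. -/
structure DblCat : Type (u + 1) where
  Obj : Type u
  Hor : Type u
  Ver : Type u
  Sq : Type u
  hor : CatStr Obj Hor
  ver : CatStr Obj Ver
  horSq : CatStr Ver Sq
  verSq : CatStr Hor Sq
  isFunctor_src : IsFunctor verSq ver hor.src horSq.src
  isFunctor_tgt : IsFunctor verSq ver hor.tgt horSq.tgt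
  isFunctor_id : IsFunctor ver verSq hor.id horSq.id
  top_comp : ∀ α β h h', verSq.src (horSq.comp α β h) = hor.comp (verSq.src α) (verSq.src β) h'
  bot_comp : ∀ α β h h', verSq.tgt (horSq.comp α β h) = hor.comp (verSq.tgt α) (verSq.tgt β) h'
  comp_id : ∀ f g h h', horSq.comp (verSq.id f) (verSq.id g) h' = verSq.id (hor.comp f g h)
  interchange : ∀ α β γ δ (hαγ : verSq.tgt α = verSq.src γ) (hβδ : verSq.tgt β = verSq.src δ)
    (hαβ : horSq.tgt α = horSq.src β) (hγδ : horSq.tgt γ = horSq.src δ) h h',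
    horSq.comp (verSq.comp α γ hαγ) (verSq.comp β δ hβδ) h =
      verSq.comp (horSq.comp α β hαβ) (horSq.comp γ δ hγδ) h'

/-- Double functors: functions on objects, horizontal morphisms, vertical morphisms and squares that
preserve all sources, targets, identities and compositions. -/
@[ext]
structure DblFunctor (D E : DblCat.{u}) where
  onObj : D.Obj → E.Obj
  onHor : D.Hor → E.Hor
  onVer : D.Ver → E.Ver
  onSq : D.Sq → E.Sq
  isFunctor_hor : IsFunctor D.hor E.hor onObj onHor
  isFunctor_ver : IsFunctor D.ver E.ver onObj onVer
  isFunctor_horSq : IsFunctor D.horSq E.horSq onVer onSq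
  isFunctor_verSq : IsFunctor D.verSq E.verSq onHor onSq

/-- The category of small double categories and double functors. -/
instance : Category.{u} DblCat.{u} where
  Hom D E := DblFunctor D E
  id D := ⟨id, id, id, id, .refl _, .refl _, .refl _, .refl _⟩
  comp F G := ⟨G.onObj ∘ F.onObj, G.onHor ∘ F.onHor, G.onVer ∘ F.onVer, G.onSq ∘ F.onSq,
    F.isFunctor_hor.trans G.isFunctor_hor, F.isFunctor_ver.trans G.isFunctor_ver,
    F.isFunctor_horSq.trans G.isFunctor_horSq, F.isFunctor_verSq.trans G.isFunctor_verSq⟩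

namespace DblCat

variable (D : DblCat.{u})

/-- Tops of squares are functorial for horizontal composition. -/
theorem isFunctor_top : IsFunctor D.horSq D.hor D.ver.src D.verSq.src where
  map_src α := (D.isFunctor_src.map_src α).symm
  map_tgt α := (D.isFunctor_tgt.map_src α).symm
  map_id j := by rw [D.isFunctor_id.map_src]
  map_comp α β h h' := D.top_comp α β h h'

/-- Bottoms of squares are functorial for horizontal composition. -/
theorem isFunctor_bot : IsFunctor D.horSq D.hor D.ver.tgt D.verSq.tgt where
  map_src α := (D.isFunctor_src.map_tgt α).symm
  map_tgt α := (D.isFunctor_tgt.map_tgt α).symm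
  map_id j := by rw [D.isFunctor_id.map_tgt]
  map_comp α β h h' := D.bot_comp α β h h'

/-- Vertical identity squares are functorial for horizontal composition. -/
theorem isFunctor_idSq : IsFunctor D.hor D.horSq D.ver.id D.verSq.id where
  map_src f := D.isFunctor_src.map_id f
  map_tgt f := D.isFunctor_tgt.map_id f
  map_id a := (D.isFunctor_id.map_id a).symm
  map_comp f g h h' := (D.comp_id f g h h').symm

end DblCat

/-! ### The horizontal nerve -/

/-- Functors from the ordered set `[n]` to the category `C`: a path of `n` composable arrows
together with all its composites. -/
@[ext]
structure PathIn {O A : Type u} (C : CatStr O A) (n : SimplexCategory) where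
  obj : Fin (n.len + 1) → O
  map : ∀ i j : Fin (n.len + 1), i ≤ j → A
  src_map : ∀ i j h, C.src (map i j h) = obj i
  tgt_map : ∀ i j h, C.tgt (map i j h) = obj j
  map_id : ∀ i h, map i i h = C.id (obj i)
  map_comp : ∀ i j k (hij : i ≤ j) (hjk : j ≤ k) (hik : i ≤ k) h,
    C.comp (map i j hij) (map j k hjk) h = map i k hik

namespace PathIn

variable {O A O' A' : Type u} {C : CatStr O A} {C' : CatStr O' A'}

/-- The action of a functor on paths. -/
def mapFunctor {fo : O → O'} {fa : A → A'} (hf : IsFunctor C C' fo fa) {n : SimplexCategory}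
    (p : PathIn C n) : PathIn C' n where
  obj i := fo (p.obj i)
  map i j h := fa (p.map i j h)
  src_map i j h := by rw [hf.map_src, p.src_map]
  tgt_map i j h := by rw [hf.map_tgt, p.tgt_map]
  map_id i h := by rw [p.map_id, hf.map_id]
  map_comp i j k hij hjk hik h := by
    rw [← hf.map_comp _ _ (by rw [p.tgt_map, p.src_map]), p.map_comp]

/-- Restriction of paths along a monotone map `[m] → [n]`. -/
def restrict {m n : SimplexCategory} (θ : m ⟶ n) (p : PathIn C n) : PathIn C m where
  obj i := p.obj (θ.toOrderHom i)
  map i j h := p.map (θ.toOrderHom i) (θ.toOrderHom j) (θ.toOrderHom.monotone h)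
  src_map _ _ _ := p.src_map _ _ _
  tgt_map _ _ _ := p.tgt_map _ _ _
  map_id _ _ := p.map_id _ _
  map_comp _ _ _ _ _ _ _ := p.map_comp _ _ _ _ _ _ _

end PathIn

namespace DblCat

variable (D : DblCat.{u})

/-- The `n`-th category of the horizontal nerve: objects are horizontal paths of `n` horizontal
morphisms, arrows are horizontal paths of `n` squares, and composition is vertical. -/
def nerveLevel (n : SimplexCategory) : CatStr (PathIn D.hor n) (PathIn D.horSq n) where
  src := PathIn.mapFunctor D.isFunctor_top
  tgt := PathIn.mapFunctor D.isFunctor_bot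
  id := PathIn.mapFunctor D.isFunctor_idSq
  comp σ τ h :=
    have ho : ∀ i, D.ver.tgt (σ.obj i) = D.ver.src (τ.obj i) := fun i =>
      congrFun (congrArg PathIn.obj h) i
    have hm : ∀ i j hij, D.verSq.tgt (σ.map i j hij) = D.verSq.src (τ.map i j hij) :=
      fun i j hij => congrFun (congrFun (congrFun (congrArg PathIn.map h) i) j) hij
    { obj i := D.ver.comp (σ.obj i) (τ.obj i) (ho i)
      map i j hij := D.verSq.comp (σ.map i j hij) (τ.map i j hij) (hm i j hij)
      src_map i j hij := by
        rw [D.isFunctor_src.map_comp _ _ _ (by rw [σ.src_map, τ.src_map, ho])]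
        exact D.ver.comp_congr (σ.src_map _ _ _) (τ.src_map _ _ _) _ _
      tgt_map i j hij := by
        rw [D.isFunctor_tgt.map_comp _ _ _ (by rw [σ.tgt_map, τ.tgt_map, ho])]
        exact D.ver.comp_congr (σ.tgt_map _ _ _) (τ.tgt_map _ _ _) _ _
      map_id i hi := by
        rw [D.isFunctor_id.map_comp _ _ _
          (by rw [D.isFunctor_id.map_tgt, D.isFunctor_id.map_src, ho])]
        exact D.verSq.comp_congr (σ.map_id _ _) (τ.map_id _ _) _ _
      map_comp i j k hij hjk hik h := by
        have h₁ : D.horSq.tgt (σ.map i j hij) = D.horSq.src (σ.map j k hjk) := by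
          rw [σ.tgt_map, σ.src_map]
        have h₂ : D.horSq.tgt (τ.map i j hij) = D.horSq.src (τ.map j k hjk) := by
          rw [τ.tgt_map, τ.src_map]
        have e₁ := σ.map_comp i j k hij hjk hik h₁
        have e₂ := τ.map_comp i j k hij hjk hik h₂
        rw [D.interchange _ _ _ _ _ _ h₁ h₂ _ (by rw [e₁, e₂, hm])]
        exact D.verSq.comp_congr e₁ e₂ _ _ }
  src_id p := by
    ext <;> simp [PathIn.mapFunctor, D.ver.src_id, D.verSq.src_id]
  tgt_id p := by
    ext <;> simp [PathIn.mapFunctor, D.ver.tgt_id, D.verSq.tgt_id]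
  src_comp σ τ h := by
    ext
    · exact D.ver.src_comp _ _ _
    · exact D.verSq.src_comp _ _ _
  tgt_comp σ τ h := by
    ext
    · exact D.ver.tgt_comp _ _ _
    · exact D.verSq.tgt_comp _ _ _
  id_comp σ h := by
    ext <;> simp [PathIn.mapFunctor, D.ver.id_comp, D.verSq.id_comp]
  comp_id σ h := by
    ext <;> simp [PathIn.mapFunctor, D.ver.comp_id, D.verSq.comp_id]
  assoc σ τ ρ h₁ h₂ h₃ h₄ := by
    ext i
    · exact D.ver.assoc _ _ _ _ _ _ _
    · exact D.verSq.assoc _ _ _ _ _ _ _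

theorem isFunctor_restrict {m n : SimplexCategory} (θ : m ⟶ n) :
    IsFunctor (D.nerveLevel n) (D.nerveLevel m) (PathIn.restrict θ) (PathIn.restrict θ) :=
  ⟨fun _ => rfl, fun _ => rfl, fun _ => rfl, fun _ _ _ _ => rfl⟩

/-- The horizontal nerve of a double category. -/
def nerve : SimplexCategoryᵒᵖ ⥤ Cat.{u, u} where
  obj n := (D.nerveLevel n.unop).toCat
  map θ := (D.isFunctor_restrict θ.unop).toFunctor.toCatHom
  map_id _ := rfl
  map_comp _ _ := rfl

variable {D} {E : DblCat.{u}}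

theorem isFunctor_nerveMap (K : D ⟶ E) (n : SimplexCategory) :
    IsFunctor (D.nerveLevel n) (E.nerveLevel n) (PathIn.mapFunctor K.isFunctor_hor)
      (PathIn.mapFunctor K.isFunctor_horSq) where
  map_src σ := by
    ext
    · exact K.isFunctor_ver.map_src _
    · exact K.isFunctor_verSq.map_src _
  map_tgt σ := by
    ext
    · exact K.isFunctor_ver.map_tgt _
    · exact K.isFunctor_verSq.map_tgt _
  map_id p := by
    ext
    · exact K.isFunctor_ver.map_id _
    · exact K.isFunctor_verSq.map_id _
  map_comp σ τ h h' := by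
    ext
    · exact K.isFunctor_ver.map_comp _ _ _ _
    · exact K.isFunctor_verSq.map_comp _ _ _ _

end DblCat

/-- The horizontal nerve functor `N_h : DblCat ⥤ Cat^{Δ^op}`. -/
def horizontalNerve : DblCat.{u} ⥤ (SimplexCategoryᵒᵖ ⥤ Cat.{u, u}) where
  obj D := D.nerve
  map K := { app n := (DblCat.isFunctor_nerveMap K n.unop).toFunctor.toCatHom }
  map_id _ := rfl
  map_comp _ _ := rfl

/-! ### The categorical structure on `Cat` and its diagram version -/

/-- Equivalences of categories. -/
def catEquivalences : MorphismProperty Cat.{u, u} := fun _ _ F => F.toFunctor.IsEquivalence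

/-- Isofibrations: every isomorphism `g : b ≅ F a` lifts to an isomorphism `f : a' ≅ a` with
`F a' = b` and `F f = g`. -/
def catIsofibrations : MorphismProperty Cat.{u, u} := fun A B F =>
  ∀ (a : A) (b : B) (g : b ≅ F.toFunctor.obj a),
    ∃ (a' : A) (f : a' ≅ a) (h : F.toFunctor.obj a' = b),
      F.toFunctor.map f.hom = eqToHom h ≫ g.hom

/-- A functor between categories in `Type`, moved to the universe of `Cat.{u, u}`. -/
def liftFunctor {A B : Type} [Category.{0} A] [Category.{0} B] (F : A ⥤ B) :
    Cat.of (AsSmall.{u} A) ⟶ Cat.of (AsSmall.{u} B) :=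
  (AsSmall.down ⋙ F ⋙ AsSmall.up).toCatHom

/-- `∅ → {1}`. -/
def emptyToPoint : Discrete PEmpty.{1} ⥤ Discrete Unit := Functor.empty _

/-- `{0, 1} → {0 → 1}`. -/
def endpoints : Discrete (Fin 2) ⥤ Fin 2 := Discrete.functor id

/-- `{0 ⇉ 1} → {0 → 1}`. -/
def parallelToArrow : WalkingParallelPair ⥤ Fin 2 :=
  parallelPair (homOfLE (Fin.zero_le 1)) (homOfLE (Fin.zero_le 1))

/-- `{1} → {0 ≅ 1}`. -/
def pointToIso : Discrete Unit ⥤ Codiscrete (Fin 2) := Functor.fromPUnit ⟨1⟩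

/-- The generating cofibrations of the categorical structure on `Cat`. -/
inductive catGenCof : MorphismProperty Cat.{u, u}
  | emptyToPoint : catGenCof (liftFunctor emptyToPoint)
  | endpoints : catGenCof (liftFunctor endpoints)
  | parallelToArrow : catGenCof (liftFunctor parallelToArrow)

/-- The generating acyclic cofibration of the categorical structure on `Cat`. -/
inductive catGenAcyclicCof : MorphismProperty Cat.{u, u}
  | pointToIso : catGenAcyclicCof (liftFunctor pointToIso)

/-- The natural transformations `∐_{Δ^op([n],-)} A → ∐_{Δ^op([n],-)} B` induced by the morphisms
`f : A → B` in `S`, for all `n`. -/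
inductive diagramGen (S : MorphismProperty Cat.{u, u}) :
    MorphismProperty (SimplexCategoryᵒᵖ ⥤ Cat.{u, u})
  | mk (n : SimplexCategoryᵒᵖ) {A B : Cat.{u, u}} (f : A ⟶ B) (hf : S f) :
    diagramGen S ((evaluationLeftAdjoint Cat.{u, u} n).map f)

/-! ### Cofibrantly generated model categories -/

section

variable {C : Type u} [Category.{v} C]

/-- The class of relative `I`-cell complexes: transfinite compositions of pushouts of elements
of `I`. -/
def relCell (I : MorphismProperty C) : MorphismProperty C :=
  MorphismProperty.transfiniteCompositions.{w} I.pushouts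

/-- A well-ordered type without maximum (a limit ordinal) is `κ`-filtered if every subset of
cardinality at most `κ` is bounded, i.e. has its supremum below the ordinal. -/
def IsOrdinalFiltered (κ : Cardinal.{w}) (J : Type w) [LinearOrder J] : Prop :=
  NoMaxOrder J ∧ ∀ S : Set J, Cardinal.mk S ≤ κ → BddAbove S

/-- The object `A` is small relative to `W`: for some cardinal `κ`, the functor `Hom(A, -)`
preserves the colimit of every continuous sequence of morphisms of `W` indexed by a `κ`-filtered
ordinal. -/
def IsSmallRelativeTo (A : C) (W : MorphismProperty C) : Prop :=
  ∃ κ : Cardinal.{w}, ∀ (J : Type w) [LinearOrder J] [SuccOrder J] [OrderBot J] [WellFoundedLT J],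
    IsOrdinalFiltered κ J → ∀ (X : J ⥤ C) [X.IsWellOrderContinuous],
      (∀ j : J, W (X.map (homOfLE (Order.le_succ j)))) →
        PreservesColimit X (coyoneda.obj (op A))

variable (C)

/-- The (complete and cocomplete) model category `C` is cofibrantly generated, with set of
generating cofibrations `I` and set of generating acyclic cofibrations `J`. -/
structure IsCofibrantlyGeneratedBy [ModelCategory C] (I J : MorphismProperty C) : Prop where
  hasLimits : HasLimitsOfSize.{w, w} C
  hasColimits : HasColimitsOfSize.{w, w} C
  isSet_I : MorphismProperty.IsSmall.{w} I
  isSet_J : MorphismProperty.IsSmall.{w} J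
  small_I : ∀ {A B : C} (i : A ⟶ B), I i → IsSmallRelativeTo.{w} A (relCell.{w} I)
  small_J : ∀ {A B : C} (j : A ⟶ B), J j → IsSmallRelativeTo.{w} A (relCell.{w} J)
  fibrations_eq : fibrations C = J.rlp
  trivialFibrations_eq : trivialFibrations C = I.rlp

end

/-! The horizontal nerve identifies double categories with the simplicial categories `X` satisfying
the Segal condition `X_{n+1} ≅ X_1 ×_{X_0} X_n` (`isSegal`). Horizontal composites are read off the
2-simplices, and interchange holds because each edge map `X_2 → X_1` is a functor. The Segal
condition is locality with respect to a set of morphisms between presentable objects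
(`isLocal_segalMaps_eq`), so it cuts a reflective, locally presentable subcategory out of
`Cat^{Δ^op}`. Hence `horizontalNerve` has a left adjoint and `DblCat` is locally presentable
(`horizontalNerve_isRightAdjoint_and_presentable`). The same argument one dimension lower, for the
nerve into simplicial sets, shows that `Cat` itself is locally presentable.

In a locally presentable category every set of morphisms admits the small object argument. So a
model structure with weak equivalences `W` and generators `I`, `J` needs, besides two-out-of-three
for `W`, only `rlp I = rlp J ∩ W` and `llp (rlp J) ⊆ W` (`exists_modelCategory`). The first follows
by adjunction from a computation in `Cat` (`catGenCof_rlp`). The second is Quillen's path object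
argument (`llp_rlp_le_levelwiseEquivalences`): every object is fibrant, and a path object is given
levelwise by the functors out of the free-living isomorphism. This construction preserves limits,
hence Segal objects, so the levelwise path object of a nerve is again a nerve. Both model structures
are cases of `exists_transferred_modelCategory`: one for the identity of `Cat^{Δ^op}`, one for the
horizontal nerve. -/

/-! ### Segal objects in a locally presentable category -/

section Segal

variable {V : Type v} [Category.{u} V]

/-- A simplicial object is Segal if `X_{n+1}` is the pullback of `X_1` and `X_n` over `X_0`, where
an `(n+1)`-simplex is cut into its initial edge and the face opposite to the initial vertex. -/
def isSegal : ObjectProperty (SimplexCategoryᵒᵖ ⥤ V) := fun X =>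
  ∀ n : ℕ, IsPullback (X.map (SimplexCategory.mkOfSucc (0 : Fin (n + 1))).op)
    (X.map (SimplexCategory.δ (0 : Fin (n + 2))).op)
    (X.map (SimplexCategory.δ (0 : Fin 2)).op)
    (X.map (SimplexCategory.const (.mk 0) (.mk n) 0).op)

theorem mkOfSucc_zero_comp_δ (n : ℕ) :
    SimplexCategory.δ (0 : Fin 2) ≫ SimplexCategory.mkOfSucc (0 : Fin (n + 1)) =
      SimplexCategory.const (.mk 0) (.mk n) 0 ≫ SimplexCategory.δ (0 : Fin (n + 2)) := by
  ext i
  fin_cases i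
  rfl

theorem segal_square_comm (X : SimplexCategoryᵒᵖ ⥤ V) (n : ℕ) :
    X.map (SimplexCategory.mkOfSucc (0 : Fin (n + 1))).op ≫
        X.map (SimplexCategory.δ (0 : Fin 2)).op =
      X.map (SimplexCategory.δ (0 : Fin (n + 2))).op ≫
        X.map (SimplexCategory.const (.mk 0) (.mk n) 0).op := by
  rw [← X.map_comp, ← X.map_comp, ← op_comp, ← op_comp, mkOfSucc_zero_comp_δ]

theorem isSegal_of_iso {X Y : SimplexCategoryᵒᵖ ⥤ V} (e : X ≅ Y) (hX : isSegal X) : isSegal Y :=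
  fun n => (hX n).of_iso (e.app _) (e.app _) (e.app _) (e.app _) (by simp) (by simp) (by simp)
    (by simp)

/-- Functors that preserve pullbacks preserve Segal objects. -/
theorem isSegal_comp {V' : Type*} [Category* V'] {X : SimplexCategoryᵒᵖ ⥤ V} (hX : isSegal X)
    (F : V ⥤ V') [PreservesLimitsOfShape WalkingCospan F] : isSegal (X ⋙ F) :=
  fun n => (hX n).map F

/-- A commutative square is a pullback if it is one when tested on a strong generator. -/
theorem isPullback_of_isStrongGenerator [HasPullbacks V] {S : ObjectProperty V}
    (hS : S.IsStrongGenerator) {P X Y Z : V} {fst : P ⟶ X} {snd : P ⟶ Y} {f : X ⟶ Z} {g : Y ⟶ Z}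
    (comm : fst ≫ f = snd ≫ g)
    (h : ∀ G, S G → ∀ (a : G ⟶ X) (b : G ⟶ Y), a ≫ f = b ≫ g →
      ∃! c : G ⟶ P, c ≫ fst = a ∧ c ≫ snd = b) : IsPullback fst snd f g := by
  -- The comparison `φ` is monic by uniqueness of `c`, and every map from a generator to the
  -- pullback factors through it by existence of `c`. For a strong generator this forces `φ` to be
  -- an isomorphism.
  let φ : P ⟶ pullback f g := pullback.lift fst snd comm
  have hφ₁ : φ ≫ pullback.fst f g = fst := pullback.lift_fst _ _ _
  have hφ₂ : φ ≫ pullback.snd f g = snd := pullback.lift_snd _ _ _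
  have : Mono φ := by
    constructor
    intro T s t hst
    refine hS.isSeparating _ _ fun G hG k => ?_
    have e₁ : s ≫ fst = t ≫ fst := by rw [← hφ₁, reassoc_of% hst]
    have e₂ : s ≫ snd = t ≫ snd := by rw [← hφ₂, reassoc_of% hst]
    refine (h G hG (k ≫ t ≫ fst) (k ≫ t ≫ snd) (by simp [comm])).unique ?_ ?_
    · simp [e₁, e₂]
    · simp
  have : IsIso φ := by
    refine hS.isIso_of_mono φ fun G hG k => ?_
    obtain ⟨c, ⟨h₁, h₂⟩, -⟩ := h G hG (k ≫ pullback.fst f g) (k ≫ pullback.snd f g)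
      (by simp [pullback.condition])
    refine ⟨c, ?_⟩
    dsimp only
    apply pullback.hom_ext
    · rw [Category.assoc, hφ₁, h₁]
    · rw [Category.assoc, hφ₂, h₂]
  exact IsPullback.of_iso_pullback ⟨comm⟩ (asIso φ) hφ₁ hφ₂

/-! ### Segal objects as local objects. -/

section Local

variable [∀ a b : SimplexCategoryᵒᵖ, HasCoproductsOfShape (a ⟶ b) V]

/-- The contravariant action of `Δ^op` on the free simplicial objects on `G`. -/
noncomputable def freeMap {m n : SimplexCategoryᵒᵖ} (θ : n ⟶ m) (G : V) :
    (evaluationLeftAdjoint V m).obj G ⟶ (evaluationLeftAdjoint V n).obj G :=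
  ((evaluationAdjunctionRight V m).homEquiv _ _).symm
    ((evaluationAdjunctionRight V n).homEquiv _ _ (𝟙 _) ≫
      ((evaluationLeftAdjoint V n).obj G).map θ)

/-- The free object corepresents `X ↦ (G ⟶ X.obj n)`. Naturality of `f` reduces the claim to the
universal element, where it is the definition of `freeMap`. -/
theorem homEquiv_freeMap_comp {m n : SimplexCategoryᵒᵖ} (θ : n ⟶ m) (G : V)
    {X : SimplexCategoryᵒᵖ ⥤ V} (f : (evaluationLeftAdjoint V n).obj G ⟶ X) :
    (evaluationAdjunctionRight V m).homEquiv _ _ (freeMap θ G ≫ f) =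
      (evaluationAdjunctionRight V n).homEquiv _ _ f ≫ X.map θ := by
  have h : f = 𝟙 _ ≫ f := (Category.id_comp f).symm
  rw [Adjunction.homEquiv_naturality_right, freeMap, Equiv.apply_symm_apply]
  conv_rhs => rw [h, Adjunction.homEquiv_naturality_right]
  simp only [evaluation_obj_map, Category.assoc, NatTrans.naturality]

theorem freeMap_comp_freeMap {l m n : SimplexCategoryᵒᵖ} (θ : n ⟶ m) (η : m ⟶ l) (G : V) :
    freeMap η G ≫ freeMap θ G = freeMap (θ ≫ η) G := by
  apply ((evaluationAdjunctionRight V l).homEquiv _ _).injective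
  have h₁ := homEquiv_freeMap_comp θ G (𝟙 _)
  have h₂ := homEquiv_freeMap_comp (θ ≫ η) G (𝟙 _)
  rw [Category.comp_id] at h₁ h₂
  rw [homEquiv_freeMap_comp, h₁, h₂, Category.assoc, ← Functor.map_comp]

variable [HasPushouts (SimplexCategoryᵒᵖ ⥤ V)]

/-- The morphism which corepresents the comparison of `Hom(G, X_{n+1})` with
`Hom(G, X_1 ×_{X_0} X_n)`. -/
noncomputable def segalMap (n : ℕ) (G : V) :
    pushout (freeMap (SimplexCategory.δ (0 : Fin 2)).op G)
      (freeMap (SimplexCategory.const (.mk 0) (.mk n) 0).op G) ⟶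
        (evaluationLeftAdjoint V (op (.mk (n + 1)))).obj G :=
  pushout.desc (freeMap (SimplexCategory.mkOfSucc (0 : Fin (n + 1))).op G)
    (freeMap (SimplexCategory.δ (0 : Fin (n + 2))).op G) (by
      rw [freeMap_comp_freeMap, freeMap_comp_freeMap, ← op_comp, ← op_comp, mkOfSucc_zero_comp_δ])

/-- The family of all Segal maps on the objects of `S`. -/
def segalMaps (S : ObjectProperty V) : MorphismProperty (SimplexCategoryᵒᵖ ⥤ V) :=
  MorphismProperty.ofHoms fun p : ℕ × Subtype S => segalMap p.1 p.2.1

theorem segalMaps_segalMap {S : ObjectProperty V} (n : ℕ) (G : V) (hG : S G) :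
    segalMaps S (segalMap n G) :=
  MorphismProperty.ofHoms.mk (f := fun p : ℕ × Subtype S => segalMap p.1 p.2.1) (n, ⟨G, hG⟩)

/-- A morphism from the pushout to `X` is a compatible pair of maps from `G` to `X_1` and `X_n`, and
precomposition with `segalMap` cuts a map from `G` to `X_{n+1}` into its two pieces. So locality is
the Segal pullback property tested on maps out of `G`. -/
theorem bijective_segalMap_comp_iff (n : ℕ) (G : V) (X : SimplexCategoryᵒᵖ ⥤ V) :
    (Function.Bijective fun g : (evaluationLeftAdjoint V (op (.mk (n + 1)))).obj G ⟶ X =>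
        segalMap n G ≫ g) ↔
      ∀ (a : G ⟶ X.obj (op (.mk 1))) (b : G ⟶ X.obj (op (.mk n))),
        a ≫ X.map (SimplexCategory.δ (0 : Fin 2)).op =
          b ≫ X.map (SimplexCategory.const (.mk 0) (.mk n) 0).op →
        ∃! c : G ⟶ X.obj (op (.mk (n + 1))),
          c ≫ X.map (SimplexCategory.mkOfSucc (0 : Fin (n + 1))).op = a ∧
            c ≫ X.map (SimplexCategory.δ (0 : Fin (n + 2))).op = b := by
  have inl (g : (evaluationLeftAdjoint V (op (.mk (n + 1)))).obj G ⟶ X) :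
      pushout.inl _ _ ≫ segalMap n G ≫ g = freeMap (SimplexCategory.mkOfSucc 0).op G ≫ g := by
    rw [segalMap, pushout.inl_desc_assoc]
  have inr (g : (evaluationLeftAdjoint V (op (.mk (n + 1)))).obj G ⟶ X) :
      pushout.inr _ _ ≫ segalMap n G ≫ g = freeMap (SimplexCategory.δ 0).op G ≫ g := by
    rw [segalMap, pushout.inr_desc_assoc]
  let E (k : ℕ) := (evaluationAdjunctionRight V (op (SimplexCategory.mk k))).homEquiv G X
  constructor
  · intro H a b hab
    have key : freeMap (SimplexCategory.δ (0 : Fin 2)).op G ≫ (E 1).symm a =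
        freeMap (SimplexCategory.const (.mk 0) (.mk n) 0).op G ≫ (E n).symm b := by
      apply (E 0).injective
      dsimp only [E]
      rw [homEquiv_freeMap_comp, homEquiv_freeMap_comp, Equiv.apply_symm_apply,
        Equiv.apply_symm_apply, hab]
    obtain ⟨g, hg⟩ := H.2 (pushout.desc _ _ key)
    dsimp only at hg
    have h₁ : freeMap (SimplexCategory.mkOfSucc 0).op G ≫ g = (E 1).symm a := by
      rw [← inl, hg, pushout.inl_desc]
    have h₂ : freeMap (SimplexCategory.δ 0).op G ≫ g = (E n).symm b := by
      rw [← inr, hg, pushout.inr_desc]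
    refine ⟨E (n + 1) g, ⟨?_, ?_⟩, ?_⟩
    · dsimp only [E]
      rw [← homEquiv_freeMap_comp, h₁, Equiv.apply_symm_apply]
    · dsimp only [E]
      rw [← homEquiv_freeMap_comp, h₂, Equiv.apply_symm_apply]
    · rintro c ⟨hc₁, hc₂⟩
      obtain ⟨c, rfl⟩ := (E (n + 1)).surjective c
      congr 1
      apply H.1
      dsimp only
      apply pushout.hom_ext
      · rw [inl, inl]
        apply (E 1).injective
        dsimp only [E] at *
        rw [h₁, homEquiv_freeMap_comp, hc₁, Equiv.apply_symm_apply]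
      · rw [inr, inr]
        apply (E n).injective
        dsimp only [E] at *
        rw [h₂, homEquiv_freeMap_comp, hc₂, Equiv.apply_symm_apply]
  · intro H
    have key (s : pushout (freeMap (SimplexCategory.δ (0 : Fin 2)).op G)
        (freeMap (SimplexCategory.const (.mk 0) (.mk n) 0).op G) ⟶ X) :
        E 1 (pushout.inl _ _ ≫ s) ≫ X.map (SimplexCategory.δ (0 : Fin 2)).op =
          E n (pushout.inr _ _ ≫ s) ≫ X.map (SimplexCategory.const (.mk 0) (.mk n) 0).op := by
      dsimp only [E]
      rw [← homEquiv_freeMap_comp, ← homEquiv_freeMap_comp, pushout.condition_assoc]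
    constructor
    · intro g g' hgg'
      dsimp only at hgg'
      apply (E (n + 1)).injective
      refine (H _ _ (key (segalMap n G ≫ g))).unique ⟨?_, ?_⟩ ⟨?_, ?_⟩
      · rw [inl]; exact (homEquiv_freeMap_comp _ _ _).symm
      · rw [inr]; exact (homEquiv_freeMap_comp _ _ _).symm
      · rw [hgg', inl]; exact (homEquiv_freeMap_comp _ _ _).symm
      · rw [hgg', inr]; exact (homEquiv_freeMap_comp _ _ _).symm
    · intro s
      obtain ⟨c, ⟨hc₁, hc₂⟩, -⟩ := H _ _ (key s)
      refine ⟨(E (n + 1)).symm c, ?_⟩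
      dsimp only
      apply pushout.hom_ext
      · rw [inl]
        apply (E 1).injective
        dsimp only [E] at *
        rw [homEquiv_freeMap_comp, Equiv.apply_symm_apply, hc₁]
      · rw [inr]
        apply (E n).injective
        dsimp only [E] at *
        rw [homEquiv_freeMap_comp, Equiv.apply_symm_apply, hc₂]

/-- Locality only tests the pullback property on maps out of objects of `S`; the strong generator
makes this sufficient. -/
theorem isLocal_segalMaps_eq [HasPullbacks V] {S : ObjectProperty V} (hS : S.IsStrongGenerator) :
    (segalMaps S).isLocal = isSegal := by
  ext X
  constructor
  · intro hX n
    exact isPullback_of_isStrongGenerator hS (segal_square_comm X n) fun G hG =>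
      (bijective_segalMap_comp_iff n G X).1 (hX _ (segalMaps_segalMap n G hG))
  · intro hX
    have key (p : ℕ × Subtype S) : Function.Bijective
        fun g : (evaluationLeftAdjoint V (op (.mk (p.1 + 1)))).obj p.2.1 ⟶ X =>
          segalMap p.1 p.2.1 ≫ g := by
      refine (bijective_segalMap_comp_iff p.1 p.2.1 X).2 fun a b hab => ?_
      refine ⟨(hX p.1).lift a b hab, ⟨(hX p.1).lift_fst _ _ _, (hX p.1).lift_snd _ _ _⟩, ?_⟩
      rintro c ⟨h₁, h₂⟩
      exact (hX p.1).hom_ext (by rw [h₁, (hX p.1).lift_fst]) (by rw [h₂, (hX p.1).lift_snd])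
    rintro _ _ _ ⟨p⟩
    exact key p

end Local

/-! ### Reflectivity and local presentability of Segal objects. -/

section LocallyPresentable

variable (V)

/-- Local presentability of functor categories is applied to a copy of `Δ` in the universe `u` and
carried back along the equivalence. -/
theorem isCardinalLocallyPresentable_simplicial [HasPullbacks V] (κ : Cardinal.{u})
    [Fact κ.IsRegular] [IsCardinalLocallyPresentable V κ] :
    IsCardinalLocallyPresentable (SimplexCategoryᵒᵖ ⥤ V) κ :=
  ((AsSmall.equiv.{0, 0, u} (C := SimplexCategory)).op.congrLeft
    (E := V)).symm.isCardinalLocallyPresentable κ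

/-- Segal objects in a locally presentable category form a reflective subcategory which is
locally presentable. -/
theorem isSegal_reflective_and_presentable [HasPullbacks V] [IsLocallyPresentable.{u} V] :
    (isSegal (V := V)).ι.IsRightAdjoint ∧
      IsLocallyPresentable.{u} (isSegal (V := V)).FullSubcategory := by
  obtain ⟨κ, _, hV⟩ := IsLocallyPresentable.exists_cardinal.{u} V
  have := isCardinalLocallyPresentable_simplicial V κ
  obtain ⟨S, _, hS, hSκ⟩ := (IsCardinalLocallyPresentable.iff_exists_isStrongGenerator V κ).1 hV
  -- Evaluation at `n` preserves filtered colimits, so its left adjoint preserves presentable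
  -- objects.
  have free (n : SimplexCategoryᵒᵖ) (G : V) (hG : S G) :
      IsCardinalPresentable ((evaluationLeftAdjoint V n).obj G) κ := by
    have : IsCardinalPresentable G κ := hSκ _ hG
    exact (evaluationAdjunctionRight V n).isCardinalPresentable_leftAdjoint_obj κ G
  have hW : ∀ ⦃X Y : SimplexCategoryᵒᵖ ⥤ V⦄ (f : X ⟶ Y), segalMaps S f →
      IsCardinalPresentable X κ ∧ IsCardinalPresentable Y κ := by
    rintro _ _ _ ⟨n, G, hG⟩
    refine ⟨?_, free _ _ hG⟩
    -- The source of a Segal map is a pushout of presentable objects, and a span is a finite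
    -- diagram, hence smaller than any regular `κ`.
    have : ∀ k, IsCardinalPresentable ((span (freeMap (SimplexCategory.δ (0 : Fin 2)).op G)
      (freeMap (SimplexCategory.const (.mk 0) (.mk n) 0).op G)).obj k) κ := by
      rintro (_ | (_ | _)) <;> exact free _ _ hG
    refine isCardinalPresentable_of_isColimit' _ (colimit.isColimit
      (span (freeMap (SimplexCategory.δ (0 : Fin 2)).op G)
        (freeMap (SimplexCategory.const (.mk 0) (.mk n) 0).op G))) κ ?_
    exact hasCardinalLT_of_finite _ _ (Fact.out : κ.IsRegular).aleph0_le
  rw [← isLocal_segalMaps_eq hS]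
  have : MorphismProperty.IsSmall.{u} (segalMaps S) := by
    unfold segalMaps
    infer_instance
  exact ⟨MorphismProperty.isRightAdjoint_ι_isLocal _ κ hW, κ, inferInstance,
    MorphismProperty.isLocallyPresentable_isLocal _ κ hW⟩

variable {V}

/-- A category whose simplicial nerve is fully faithful with essential image the Segal objects is
locally presentable, and the nerve has a left adjoint. -/
theorem isRightAdjoint_and_presentable_of_essImage_eq_isSegal [HasPullbacks V]
    [IsLocallyPresentable.{u} V] {C : Type*} [Category.{u} C] (N : C ⥤ (SimplexCategoryᵒᵖ ⥤ V))
    [N.Full] [N.Faithful] (hN : ∀ D, isSegal (N.obj D))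
    (hN' : ∀ X, isSegal X → ∃ D, Nonempty (N.obj D ≅ X)) :
    N.IsRightAdjoint ∧ IsLocallyPresentable.{u} C := by
  obtain ⟨h₁, h₂⟩ := isSegal_reflective_and_presentable V
  let N' : C ⥤ (isSegal (V := V)).FullSubcategory := isSegal.lift N hN
  have : N'.EssSurj := ⟨fun X => by
    obtain ⟨D, ⟨e⟩⟩ := hN' X.1 X.2
    exact ⟨D, ⟨isSegal.isoMk e⟩⟩⟩
  have : N'.IsEquivalence := { }
  exact ⟨inferInstanceAs (N' ⋙ isSegal.ι).IsRightAdjoint,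
    N'.asEquivalence.symm.isLocallyPresentable⟩

end LocallyPresentable

end Segal

/-! ### Segal simplicial sets and categories -/

namespace SegalSet

variable (X : SimplexCategoryᵒᵖ ⥤ Type u)

theorem map_op_map_op {l m n : SimplexCategory} (η : l ⟶ m) (θ : m ⟶ n) (x : X.obj (op n)) :
    X.map η.op (X.map θ.op x) = X.map (η ≫ θ).op x := by
  rw [op_comp, X.map_comp]; rfl

/-- The `i`-th vertex of a simplex. -/
def vertex {n : SimplexCategory} (x : X.obj (op n)) (i : Fin (n.len + 1)) : X.obj (op (.mk 0)) :=
  X.map (SimplexCategory.const (.mk 0) n i).op x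

/-- The edge of a simplex from the `i`-th to the `j`-th vertex. -/
def edge {n : SimplexCategory} (x : X.obj (op n)) (i j : Fin (n.len + 1)) (h : i ≤ j) :
    X.obj (op (.mk 1)) :=
  X.map (SimplexCategory.mkOfLe i j h).op x

variable {X}

theorem vertex_map {m n : SimplexCategory} (θ : m ⟶ n) (x : X.obj (op n)) (i : Fin (m.len + 1)) :
    vertex X (X.map θ.op x) i = vertex X x (θ.toOrderHom i) := by
  simp only [vertex, map_op_map_op]
  congr 1

theorem edge_map {m n : SimplexCategory} (θ : m ⟶ n) (x : X.obj (op n)) (i j : Fin (m.len + 1))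
    (h : i ≤ j) :
    edge X (X.map θ.op x) i j h =
      edge X x (θ.toOrderHom i) (θ.toOrderHom j) (θ.toOrderHom.monotone h) := by
  simp only [edge, map_op_map_op]
  congr 4
  exact SimplexCategory.Hom.ext_one_left _ _ rfl rfl

theorem vertex_edge {n : SimplexCategory} (x : X.obj (op n)) (i j : Fin (n.len + 1)) (h : i ≤ j)
    (k : Fin 2) : vertex X (edge X x i j h) k = vertex X x (if k = 0 then i else j) := by
  rw [edge, vertex_map]
  fin_cases k <;> rfl

theorem vertex_zero (x : X.obj (op (.mk 0))) (i : Fin 1) : vertex X x i = x := by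
  have h : SimplexCategory.const (.mk 0) (.mk 0) i = 𝟙 _ := Subsingleton.elim _ _
  rw [vertex, h, op_id, X.map_id]; rfl

theorem edge_one (x : X.obj (op (.mk 1))) : edge X x 0 1 (Fin.zero_le 1) = x := by
  have h : SimplexCategory.mkOfLe (0 : Fin 2) 1 (Fin.zero_le 1) = 𝟙 (SimplexCategory.mk 1) :=
    SimplexCategory.Hom.ext_one_left _ _ rfl rfl
  rw [edge, h, op_id, X.map_id]; rfl

theorem map_mkOfSucc {n : ℕ} (x : X.obj (op (.mk (n + 1)))) :
    X.map (SimplexCategory.mkOfSucc (0 : Fin (n + 1))).op x = edge X x 0 1 (Fin.zero_le 1) := by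
  rw [edge]
  congr 4

/-- The degenerate edge at a vertex. -/
def degenerate (a : X.obj (op (.mk 0))) : X.obj (op (.mk 1)) :=
  X.map (SimplexCategory.const (.mk 1) (.mk 0) 0).op a

theorem vertex_degenerate (a : X.obj (op (.mk 0))) (i : Fin 2) : vertex X (degenerate a) i = a := by
  rw [degenerate, vertex_map, vertex_zero]

theorem edge_self {n : SimplexCategory} (x : X.obj (op n)) (i : Fin (n.len + 1)) (h : i ≤ i) :
    edge X x i i h = degenerate (vertex X x i) := by
  rw [edge, degenerate, vertex, map_op_map_op]
  congr 4
  exact SimplexCategory.Hom.ext_one_left _ _ rfl rfl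

/-- This is the uniqueness half of the Segal pullback, and `exists_of_isSegal` is the existence
half. Together they allow induction on the dimension, removing the initial edge. -/
theorem ext_of_isSegal (hX : isSegal X) {n : ℕ} {x y : X.obj (op (.mk (n + 1)))}
    (h₁ : edge X x 0 1 (Fin.zero_le 1) = edge X y 0 1 (Fin.zero_le 1))
    (h₂ : X.map (SimplexCategory.δ (0 : Fin (n + 2))).op x =
      X.map (SimplexCategory.δ (0 : Fin (n + 2))).op y) : x = y :=
  Types.ext_of_isPullback (hX n) (by rw [map_mkOfSucc, map_mkOfSucc, h₁]) h₂

theorem exists_of_isSegal (hX : isSegal X) {n : ℕ} (f : X.obj (op (.mk 1)))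
    (y : X.obj (op (.mk n))) (h : vertex X f 1 = vertex X y 0) :
    ∃ x : X.obj (op (.mk (n + 1))), edge X x 0 1 (Fin.zero_le 1) = f ∧
      X.map (SimplexCategory.δ (0 : Fin (n + 2))).op x = y := by
  obtain ⟨x, h₁, h₂⟩ := Types.exists_of_isPullback (hX n) f y (by
    refine Eq.trans ?_ h
    rw [vertex]
    congr 4
    exact SimplexCategory.Hom.ext_zero_left _ _ rfl)
  exact ⟨x, by rw [← map_mkOfSucc, h₁], h₂⟩

theorem exists_triangle (hX : isSegal X) (f g : X.obj (op (.mk 1)))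
    (h : vertex X f 1 = vertex X g 0) :
    ∃ x : X.obj (op (.mk 2)), edge X x 0 1 (Fin.zero_le _) = f ∧
      edge X x 1 2 (by decide) = g := by
  obtain ⟨x, h₁, h₂⟩ := exists_of_isSegal hX f g h
  refine ⟨x, h₁, ?_⟩
  rw [← edge_one g, ← h₂, edge_map]
  rfl

theorem triangle_unique (hX : isSegal X) {x y : X.obj (op (.mk 2))}
    (h₁ : edge X x 0 1 (Fin.zero_le _) = edge X y 0 1 (Fin.zero_le _))
    (h₂ : edge X x 1 2 (by decide) = edge X y 1 2 (by decide)) : x = y := by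
  refine ext_of_isSegal hX h₁ ?_
  rw [← edge_one (X.map _ x), ← edge_one (X.map _ y), edge_map, edge_map]
  exact h₂

/-- The composite of two composable edges of a Segal simplicial set. -/
noncomputable def comp (hX : isSegal X) (f g : X.obj (op (.mk 1)))
    (h : vertex X f 1 = vertex X g 0) : X.obj (op (.mk 1)) :=
  edge X (exists_triangle hX f g h).choose 0 2 (Fin.zero_le _)

/-- By uniqueness, the triangle chosen to define the composite is the face of `x` on `i`, `j`, `k`.
Each law of the presented category then follows from a simplex that displays it. -/
theorem comp_edge (hX : isSegal X) {n : SimplexCategory} (x : X.obj (op n))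
    (i j k : Fin (n.len + 1)) (hij : i ≤ j) (hjk : j ≤ k) (h) :
    comp hX (edge X x i j hij) (edge X x j k hjk) h = edge X x i k (hij.trans hjk) := by
  have hs := (exists_triangle hX _ _ h).choose_spec
  have e : (exists_triangle hX _ _ h).choose =
      X.map (SimplexCategory.mkOfLeComp (n := n.len) i j k hij hjk).op x := by
    refine triangle_unique hX ?_ ?_
    · rw [hs.1, edge_map]; rfl
    · rw [hs.2, edge_map]; rfl
  rw [comp, e, edge_map]
  rfl

/-- The edges enter through equations, since rewriting them in place would disturb the composability
proof `h`. -/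
theorem comp_eq (hX : isSegal X) {f g : X.obj (op (.mk 1))} (h) {n : SimplexCategory}
    (x : X.obj (op n)) (i j k : Fin (n.len + 1)) (hij : i ≤ j) (hjk : j ≤ k)
    (hf : edge X x i j hij = f) (hg : edge X x j k hjk = g) :
    comp hX f g h = edge X x i k (hij.trans hjk) := by
  subst hf hg
  exact comp_edge hX x i j k hij hjk h

/-- The category presented by a Segal simplicial set. -/
noncomputable def catStr (hX : isSegal X) : CatStr (X.obj (op (.mk 0))) (X.obj (op (.mk 1))) where
  src f := vertex X f 0
  tgt f := vertex X f 1
  id := degenerate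
  comp := comp hX
  src_id a := vertex_degenerate a 0
  tgt_id a := vertex_degenerate a 1
  src_comp f g h := by
    obtain ⟨x, rfl, rfl⟩ := exists_triangle hX f g h
    rw [comp_edge, vertex_edge, vertex_edge]; rfl
  tgt_comp f g h := by
    obtain ⟨x, rfl, rfl⟩ := exists_triangle hX f g h
    rw [comp_edge, vertex_edge, vertex_edge]; rfl
  id_comp f h := by
    rw [comp_eq hX h f 0 0 1 le_rfl (Fin.zero_le _) (edge_self f 0 _) (edge_one f), edge_one]
  comp_id f h := by
    rw [comp_eq hX h f 0 1 1 (Fin.zero_le _) le_rfl (edge_one f) (edge_self f 1 _), edge_one]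
  assoc f g k h₁ h₂ h₃ h₄ := by
    -- The triangle on `g`, `k` is extended by `f` to a 3-simplex `x`. Both bracketings equal its
    -- edge from 0 to 3.
    obtain ⟨y, rfl, rfl⟩ := exists_triangle hX g k h₂
    obtain ⟨x, rfl, rfl⟩ := exists_of_isSegal hX f y
      (h₁.trans (by rw [vertex_edge]; rfl))
    have e₁ : edge X (X.map (SimplexCategory.δ (0 : Fin 4)).op x) 0 1 (Fin.zero_le _) =
        edge X x 1 2 (by decide) := by rw [edge_map]; rfl
    have e₂ : edge X (X.map (SimplexCategory.δ (0 : Fin 4)).op x) 1 2 (by decide) =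
        edge X x 2 3 (by decide) := by rw [edge_map]; rfl
    rw [comp_eq hX h₃ x 0 2 3 (by decide) (by decide)
        (comp_eq hX h₁ x 0 1 2 (by decide) (by decide) rfl e₁.symm).symm e₂.symm,
      comp_eq hX h₄ x 0 1 3 (by decide) (by decide) rfl
        (comp_eq hX h₂ x 1 2 3 (by decide) (by decide) e₁.symm e₂.symm).symm]

/-- The path of edges of a simplex. -/
noncomputable def toPath (hX : isSegal X) {n : SimplexCategory} (x : X.obj (op n)) :
    PathIn (catStr hX) n where
  obj := vertex X x
  map := edge X x
  src_map i j h := vertex_edge x i j h 0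
  tgt_map i j h := vertex_edge x i j h 1
  map_id i h := edge_self x i h
  map_comp i j k hij hjk _ h := comp_edge hX x i j k hij hjk h

theorem restrict_toPath (hX : isSegal X) {m n : SimplexCategory} (θ : m ⟶ n) (x : X.obj (op n)) :
    (toPath hX x).restrict θ = toPath hX (X.map θ.op x) := by
  ext
  · exact (vertex_map _ _ _).symm
  · exact (edge_map _ _ _ _ _).symm

/-- Naturality of the category presented by a Segal simplicial set. -/
theorem isFunctor_catStr {Y : SimplexCategoryᵒᵖ ⥤ Type u} (hX : isSegal X) (hY : isSegal Y)
    (φ : ∀ n, X.obj n → Y.obj n)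
    (hφ : ∀ {m n : SimplexCategory} (θ : m ⟶ n) (x : X.obj (op n)),
      φ _ (X.map θ.op x) = Y.map θ.op (φ _ x)) :
    IsFunctor (catStr hX) (catStr hY) (φ _) (φ _) where
  map_src f := (hφ _ _).symm
  map_tgt f := (hφ _ _).symm
  map_id a := hφ _ _
  map_comp f g h h' := by
    obtain ⟨x, rfl, rfl⟩ := exists_triangle hX f g h
    have e (i j hij) : φ _ (edge X x i j hij) = edge Y (φ _ x) i j hij := hφ _ _
    refine Eq.trans ?_ (comp_eq hY h' (φ _ x) 0 1 2 (by decide) (by decide)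
      (e _ _ _).symm (e _ _ _).symm).symm
    rw [← e]
    exact congrArg _ (comp_edge hX x 0 1 2 _ _ h)

end SegalSet

/-! ### Paths as simplices of the nerve. -/

namespace PathIn

variable {O A : Type u} {C : CatStr O A}

/-- An arrow from 0 to a later vertex is the initial edge followed by an arrow of the opposite face.
This is the counterpart for paths of `ext_of_isSegal`. -/
theorem ext_succ {n : ℕ} {p q : PathIn C (.mk (n + 1))}
    (h₁ : p.map 0 1 (Fin.zero_le _) = q.map 0 1 (Fin.zero_le _))
    (h₂ : p.restrict (SimplexCategory.δ 0) = q.restrict (SimplexCategory.δ 0)) : p = q := by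
  have ho (i : Fin (n + 1)) : p.obj i.succ = q.obj i.succ := congrFun (congrArg PathIn.obj h₂) i
  have hm (i j : Fin (n + 1)) (hij : i ≤ j) (hij' : i.succ ≤ j.succ) :
      p.map i.succ j.succ hij' = q.map i.succ j.succ hij' :=
    congrFun (congrFun (congrFun (congrArg PathIn.map h₂) i) j) hij
  have h₀ : p.obj 0 = q.obj 0 := by
    rw [← p.src_map 0 1 (Fin.zero_le _), ← q.src_map 0 1 (Fin.zero_le _), h₁]
  have hobj : p.obj = q.obj := by
    funext (i : Fin (n + 2))
    induction i using Fin.cases with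
    | zero => exact h₀
    | succ i => exact ho i
  have hmap : p.map = q.map := by
    funext (i : Fin (n + 2)) (j : Fin (n + 2)) hij
    induction i using Fin.cases with
    | zero =>
      induction j using Fin.cases with
      | zero => rw [p.map_id, q.map_id, h₀]
      | succ j =>
        have hle : (1 : Fin (n + 2)) ≤ j.succ := by
          rw [← Fin.succ_zero_eq_one]; exact Fin.succ_le_succ_iff.2 (Fin.zero_le _)
        rw [← p.map_comp 0 1 j.succ (Fin.zero_le _) hle hij (by rw [p.tgt_map, p.src_map]),
          ← q.map_comp 0 1 j.succ (Fin.zero_le _) hle hij (by rw [q.tgt_map, q.src_map])]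
        exact C.comp_congr h₁ (hm 0 j (Fin.zero_le _) hle) _ _
    | succ i =>
      induction j using Fin.cases with
      | zero => exact absurd hij (by simp)
      | succ j => exact hm i j (Fin.succ_le_succ_iff.1 hij) hij
  exact PathIn.ext hobj hmap

/-- The simplicial set of paths in a category. -/
def simplicialSet (C : CatStr O A) : SimplexCategoryᵒᵖ ⥤ Type u where
  obj n := PathIn C n.unop
  map θ := ↾restrict θ.unop

/-- A path as a functor. -/
def toFunctor {n : SimplexCategory} (p : PathIn C n) : Fin (n.len + 1) ⥤ C.Carrier where
  obj := p.obj
  map f := ⟨p.map _ _ (leOfHom f), p.src_map _ _ _, p.tgt_map _ _ _⟩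
  map_id _ := Subtype.ext (p.map_id _ _)
  map_comp _ _ := Subtype.ext (p.map_comp _ _ _ _ _ _ _).symm

/-- A functor as a path. -/
def ofFunctor {n : SimplexCategory} (F : Fin (n.len + 1) ⥤ C.Carrier) : PathIn C n where
  obj := F.obj
  map _ _ h := (F.map (homOfLE h)).1
  src_map _ _ h := (F.map (homOfLE h)).2.1
  tgt_map _ _ h := (F.map (homOfLE h)).2.2
  map_id i _ := congrArg Subtype.val (F.map_id i)
  map_comp _ _ _ hij hjk _ _ := congrArg Subtype.val (F.map_comp (homOfLE hij) (homOfLE hjk)).symm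

/-- Paths are simplices of the nerve. -/
def simplicialSetIso (C : CatStr O A) : simplicialSet C ≅ nerve C.Carrier :=
  NatIso.ofComponents (fun n =>
    { hom := ↾fun p => p.toFunctor
      inv := ↾fun F => ofFunctor F }) (fun θ => rfl)

/-- The path of a single arrow. -/
def ofArrow (f : A) : PathIn C (.mk 1) :=
  ofFunctor (ComposableArrows.mk₁ (C := C.Carrier) (X₀ := C.src f) (X₁ := C.tgt f) ⟨f, rfl, rfl⟩)

/-- The path of two composable arrows. -/
def ofComposable (f g : A) (h : C.tgt f = C.src g) : PathIn C (.mk 2) :=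
  ofFunctor (ComposableArrows.mk₂ (C := C.Carrier) (X₀ := C.src f) (X₁ := C.tgt f) (X₂ := C.tgt g)
    ⟨f, rfl, rfl⟩ ⟨g, h.symm, rfl⟩)

/-- The path of length zero at an object. -/
def ofObj (a : O) : PathIn C (.mk 0) :=
  ofFunctor (ComposableArrows.mk₀ (C := C.Carrier) a)

theorem eq_ofObj (p : PathIn C (.mk 0)) : p = ofObj (p.obj 0) := by
  ext i j
  · fin_cases i; rfl
  · fin_cases i; fin_cases j
    exact p.map_id _ _

theorem eq_ofArrow (p : PathIn C (.mk 1)) : p = ofArrow (p.map 0 1 (Fin.zero_le _)) := by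
  refine ext_succ rfl ?_
  rw [eq_ofObj (p.restrict _), eq_ofObj (restrict _ (ofArrow _))]
  congr 1
  exact (p.tgt_map 0 1 _).symm

end PathIn

/-- Existence is splicing an arrow in front of a string. The `eqToHom` bridges the target of the
arrow and the start of the string, which are only propositionally equal. -/
theorem isSegal_nerve (C : Type u) [Category.{u} C] : isSegal (nerve C) := fun n => by
  rw [Types.isPullback_iff]
  refine ⟨segal_square_comm _ _, ?_, fun f s h => ?_⟩
  · rintro f g ⟨h, h₀⟩
    exact ComposableArrows.ext_succ (Functor.congr_obj h 0) h₀
      ((Arrow.mk_eq_mk_iff _ _).1 (DFunLike.congr_arg ComposableArrows.arrowEquiv h)).2.2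
  · exact ⟨ComposableArrows.precomp s (f.hom ≫ eqToHom (Functor.congr_obj h 0)),
      ComposableArrows.ext₁ rfl (Functor.congr_obj h 0).symm (by
        refine Eq.trans ?_ (Category.id_comp _).symm
        rfl), rfl⟩

namespace PathIn

variable {O A : Type u} {C : CatStr O A}

theorem isSegal_simplicialSet (C : CatStr O A) : isSegal (simplicialSet C) :=
  isSegal_of_iso (simplicialSetIso C).symm (isSegal_nerve _)

end PathIn

namespace SegalSet

variable {X : SimplexCategoryᵒᵖ ⥤ Type u}

/-- Simplices and paths are both determined by the initial edge and the opposite face, and `toPath`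
respects this decomposition; hence the induction, here and for surjectivity. -/
theorem toPath_injective (hX : isSegal X) (n : ℕ) :
    Function.Injective (toPath hX (n := .mk n)) := by
  induction n with
  | zero =>
    intro x y h
    rw [← vertex_zero x 0, ← vertex_zero y 0]
    exact congrFun (congrArg PathIn.obj h) 0
  | succ n ih =>
    intro x y h
    refine ext_of_isSegal hX
      (congrFun (congrFun (congrFun (congrArg PathIn.map h) 0) 1) (Fin.zero_le 1)) (ih ?_)
    rw [← restrict_toPath, ← restrict_toPath, h]

theorem toPath_surjective (hX : isSegal X) (n : ℕ) :
    Function.Surjective (toPath hX (n := .mk n)) := by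
  induction n with
  | zero =>
    intro p
    refine ⟨p.obj 0, ?_⟩
    rw [PathIn.eq_ofObj p, PathIn.eq_ofObj (toPath _ _)]
    congr 1
    exact vertex_zero _ _
  | succ n ih =>
    intro p
    obtain ⟨y, hy⟩ := ih (p.restrict (SimplexCategory.δ 0))
    obtain ⟨x, hx₁, hx₂⟩ := exists_of_isSegal hX (p.map 0 1 (Fin.zero_le _)) y
      ((p.tgt_map 0 1 _).trans (congrFun (congrArg PathIn.obj hy) 0).symm)
    refine ⟨x, PathIn.ext_succ hx₁ ?_⟩
    rw [restrict_toPath, hx₂, hy]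

theorem toPath_bijective (hX : isSegal X) (n : SimplexCategory) :
    Function.Bijective (toPath hX (n := n)) :=
  ⟨toPath_injective hX n.len, toPath_surjective hX n.len⟩

/-- A Segal simplicial set is the simplicial set of paths in the category it presents. -/
noncomputable def toPathIso (hX : isSegal X) : X ≅ PathIn.simplicialSet (catStr hX) :=
  NatIso.ofComponents (fun n => (Equiv.ofBijective _ (toPath_bijective hX n.unop)).toIso)
    (fun θ => by
      ext x
      exact (restrict_toPath hX θ.unop x).symm)

end SegalSet

/-- The category of small categories is locally presentable. -/
instance : IsLocallyPresentable.{u} Cat.{u, u} :=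
  (isRightAdjoint_and_presentable_of_essImage_eq_isSegal nerveFunctor.{u, u}
    (fun C => isSegal_nerve C) (fun _ hX => ⟨(SegalSet.catStr hX).toCat,
      ⟨(PathIn.simplicialSetIso _).symm ≪≫ (SegalSet.toPathIso hX).symm⟩⟩)).2

/-! ### Arrows of categories -/

section Arrows

/-- The set of arrows of a category. -/
def catArrows : Cat.{u, u} ⥤ Type u where
  obj C := Arrow C
  map F := ↾F.toFunctor.mapArrow.obj

/-- The free-living arrow. -/
abbrev walkingArrow : Cat.{u, u} := Cat.of (AsSmall.{u} (Fin 2))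

/-- Functors from the free-living arrow are arrows. -/
def walkingArrowEquiv (C : Cat.{u, u}) : (walkingArrow.{u} ⟶ C) ≃ Arrow C where
  toFun F := Arrow.mk (F.toFunctor.map (AsSmall.up.map (homOfLE (Fin.zero_le 1 : (0 : Fin 2) ≤ 1))))
  invFun f := (AsSmall.down ⋙ ComposableArrows.mk₁ f.hom).toCatHom
  left_inv F := by
    refine Cat.Hom.ext ?_
    have h : ComposableArrows.mk₁ (F.toFunctor.map
        (AsSmall.up.map (homOfLE (Fin.zero_le 1 : (0 : Fin 2) ≤ 1)))) =
          (AsSmall.up ⋙ F.toFunctor : ComposableArrows C 1) :=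
      ComposableArrows.ext₁ rfl rfl ((Category.id_comp _).trans (Category.comp_id _)).symm
    exact congrArg (fun G => AsSmall.down ⋙ G) h
  right_inv f := rfl

theorem walkingArrowEquiv_comp {C D : Cat.{u, u}} (f : walkingArrow.{u} ⟶ C) (F : C ⟶ D) :
    walkingArrowEquiv D (f ≫ F) = F.toFunctor.mapArrow.obj (walkingArrowEquiv C f) :=
  rfl

instance : PreservesLimits catArrows.{u} :=
  preservesLimits_of_natIso (F := coyoneda.obj (op walkingArrow.{u}))
    (NatIso.ofComponents (fun C => (walkingArrowEquiv C).toIso) (fun _ => rfl))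

theorem catHom_ext_of_arrows {C D : Cat.{u, u}} {F G : C ⟶ D}
    (h : ∀ f : Arrow C, F.toFunctor.mapArrow.obj f = G.toFunctor.mapArrow.obj f) : F = G := by
  refine Cat.Hom.ext (CategoryTheory.Functor.ext (fun a => congrArg Comma.left (h (Arrow.mk (𝟙 a)))) ?_)
  intro a b f
  exact ((Arrow.mk_eq_mk_iff _ _).1 (h (Arrow.mk f))).2.2

/-- A fully faithful functor which is bijective on objects is an isomorphism of categories. -/
theorem isIso_of_bijective_obj {C D : Cat.{u, u}} (F : C ⟶ D) [F.toFunctor.Full]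
    [F.toFunctor.Faithful] (h : Function.Bijective F.toFunctor.obj) : IsIso F := by
  let e := Equiv.ofBijective _ h
  have he (d : D) : F.toFunctor.obj (e.symm d) = d := e.apply_symm_apply d
  let G : D ⥤ C :=
    { obj := e.symm
      map g := F.toFunctor.preimage (eqToHom (he _) ≫ g ≫ eqToHom (he _).symm)
      map_id d := F.toFunctor.map_injective (by simp)
      map_comp f g := F.toFunctor.map_injective (by simp) }
  have hG {a b : D} (g : a ⟶ b) :
      F.toFunctor.map (G.map g) = eqToHom (he _) ≫ g ≫ eqToHom (he _).symm :=
    F.toFunctor.map_preimage _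
  have he' (c : C) : (F.toFunctor ⋙ G).obj c = (𝟭 C : C ⥤ C).obj c := e.symm_apply_apply c
  have h₁ : F.toFunctor ⋙ G = 𝟭 C :=
    CategoryTheory.Functor.ext he' fun a b f => F.toFunctor.map_injective (by
      rw [Functor.comp_map, hG, Functor.map_comp, Functor.map_comp, eqToHom_map, eqToHom_map]
      rfl)
  have h₂ : G ⋙ F.toFunctor = 𝟭 D := CategoryTheory.Functor.ext he fun a b f => hG f
  exact ⟨G.toCatHom, Cat.Hom.ext h₁, Cat.Hom.ext h₂⟩

/-- A functor which is bijective on arrows is an isomorphism of categories. -/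
theorem isIso_of_bijective_arrows {C D : Cat.{u, u}} (F : C ⟶ D)
    (h : Function.Bijective F.toFunctor.mapArrow.obj) : IsIso F := by
  have inj {a b : C} (hab : F.toFunctor.obj a = F.toFunctor.obj b) : a = b := by
    -- Objects are compared through their identity arrows.
    have : Arrow.mk (𝟙 a) = Arrow.mk (𝟙 b) := h.1 (by
      change Arrow.mk (F.toFunctor.map (𝟙 a)) = Arrow.mk (F.toFunctor.map (𝟙 b))
      rw [F.toFunctor.map_id, F.toFunctor.map_id, hab])
    exact congrArg Comma.left this
  have : F.toFunctor.Faithful := ⟨fun {a b f g} hfg => by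
    have : Arrow.mk f = Arrow.mk g := h.1 (by simp [hfg])
    exact Arrow.mk_injective _ _ this⟩
  have : F.toFunctor.Full := ⟨fun {a b} g => by
    obtain ⟨f, hf⟩ := h.2 (Arrow.mk g)
    obtain rfl : f.left = a := inj (congrArg Comma.left hf)
    obtain rfl : f.right = b := inj (congrArg Comma.right hf)
    exact ⟨f.hom, Arrow.mk_injective _ _ hf⟩⟩
  refine isIso_of_bijective_obj F ⟨fun _ _ => inj, fun d => ?_⟩
  obtain ⟨f, hf⟩ := h.2 (Arrow.mk (𝟙 d))
  exact ⟨f.left, congrArg Comma.left hf⟩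

/-- Maps out of the free-living arrow are arrows, and these determine functors. A monomorphism is
injective on arrows; if it is also surjective on them, it is an isomorphism. -/
theorem isStrongGenerator_walkingArrow :
    (ObjectProperty.singleton walkingArrow.{u}).IsStrongGenerator := by
  rw [ObjectProperty.isStrongGenerator_iff]
  constructor
  · intro C D F G h
    refine catHom_ext_of_arrows fun f => ?_
    have := h _ (by simp) ((walkingArrowEquiv C).symm f)
    simpa [walkingArrowEquiv_comp] using congrArg (walkingArrowEquiv D) this
  · intro C D F _ h
    refine isIso_of_bijective_arrows F ⟨fun f g hfg => ?_, fun g => ?_⟩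
    · apply (walkingArrowEquiv C).symm.injective
      rw [← cancel_mono F]
      apply (walkingArrowEquiv D).injective
      simpa [walkingArrowEquiv_comp] using hfg
    · obtain ⟨f, hf⟩ := h _ (by simp) ((walkingArrowEquiv D).symm g)
      refine ⟨walkingArrowEquiv C f, ?_⟩
      rw [← walkingArrowEquiv_comp]
      exact (Equiv.eq_symm_apply _).1 hf

/-- A simplicial category is Segal if its simplicial set of arrows is. -/
theorem isSegal_of_arrows {X : SimplexCategoryᵒᵖ ⥤ Cat.{u, u}} (hX : isSegal (X ⋙ catArrows)) :
    isSegal X := fun n => by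
  refine isPullback_of_isStrongGenerator isStrongGenerator_walkingArrow
    (segal_square_comm X n) ?_
  rintro G hG a b hab
  obtain rfl : walkingArrow = G := by simpa using hG
  obtain ⟨x, h₁, h₂⟩ := Types.exists_of_isPullback (hX n) (walkingArrowEquiv _ a)
    (walkingArrowEquiv _ b) (congrArg (walkingArrowEquiv _) hab)
  obtain ⟨c, rfl⟩ := (walkingArrowEquiv _).surjective x
  refine ⟨c, ⟨(walkingArrowEquiv _).injective h₁, (walkingArrowEquiv _).injective h₂⟩, ?_⟩
  rintro c' ⟨hc₁, hc₂⟩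
  exact (walkingArrowEquiv _).injective (Types.ext_of_isPullback (hX n)
    (Eq.trans (congrArg (walkingArrowEquiv _) hc₁) h₁.symm)
    (Eq.trans (congrArg (walkingArrowEquiv _) hc₂) h₂.symm))

end Arrows

/-! ### Categories as pairs of sets -/

namespace CatStr

/-- The set-theoretic presentation of a category. -/
def ofCat (C : Type u) [Category.{u} C] : CatStr C (Arrow C) where
  src f := f.left
  tgt f := f.right
  id a := Arrow.mk (𝟙 a)
  comp f g h := Arrow.mk (f.hom ≫ eqToHom h ≫ g.hom)
  src_id _ := rfl
  tgt_id _ := rfl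
  src_comp _ _ _ := rfl
  tgt_comp _ _ _ := rfl
  id_comp f h := by simp
  comp_id f h := by simp
  assoc f g k h₁ h₂ h₃ h₄ := by simp

theorem ofCat_comp_mk {C : Type u} [Category.{u} C] {a b c : C} (f : a ⟶ b) (g : b ⟶ c) (h) :
    (ofCat C).comp (Arrow.mk f) (Arrow.mk g) h = Arrow.mk (f ≫ g) := by
  simp [ofCat]

theorem isFunctor_ofCat {C D : Type u} [Category.{u} C] [Category.{u} D] (F : C ⥤ D) :
    IsFunctor (ofCat C) (ofCat D) F.obj F.mapArrow.obj where
  map_src _ := rfl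
  map_tgt _ := rfl
  map_id a := congrArg Arrow.mk (F.map_id a)
  map_comp f g h h' := by
    obtain ⟨a, b, f⟩ := f
    obtain ⟨b', c, g⟩ := g
    have hb : b = b' := h
    subst hb
    exact (congrArg F.mapArrow.obj (ofCat_comp_mk f g h)).trans
      ((congrArg Arrow.mk (F.map_comp f g)).trans (ofCat_comp_mk _ _ h').symm)

variable {O A O' A' : Type u} {C : CatStr O A} {C' : CatStr O' A'}

/-- Arrows of `C.Carrier` are elements of `A`, so they can be compared there without transport along
equalities of objects. -/
theorem functor_ext {B : Type*} [Category* B] {F G : B ⥤ C.Carrier} (h : ∀ b, F.obj b = G.obj b)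
    (h' : ∀ {a b : B} (f : a ⟶ b), (F.map f).1 = (G.map f).1) : F = G := by
  obtain ⟨Fo, Fm, _, _⟩ := F
  obtain ⟨Go, Gm, _, _⟩ := G
  obtain rfl : Fo = Go := funext h
  obtain rfl : @Fm = @Gm := by
    funext a b f
    exact Subtype.ext (h' f)
  rfl

/-- Arrows of the category given by `C` are elements of `A`. -/
def arrowEquiv (C : CatStr O A) : Arrow C.Carrier ≃ A where
  toFun f := f.hom.1
  invFun f := Arrow.mk (X := (C.src f : C.Carrier)) (Y := C.tgt f) ⟨f, rfl, rfl⟩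
  left_inv f := by
    obtain ⟨a, b, ⟨f, h₁, h₂⟩⟩ := f
    change C.src f = a at h₁
    change C.tgt f = b at h₂
    subst h₁ h₂
    rfl
  right_inv _ := rfl

/-- The action of a functor on arrows. -/
def mapArrow (F : C.Carrier ⥤ C'.Carrier) (f : A) : A' :=
  (F.map (X := (C.src f : C.Carrier)) (Y := C.tgt f) ⟨f, rfl, rfl⟩).1

theorem mapArrow_eq (F : C.Carrier ⥤ C'.Carrier) {a b : C.Carrier} (f : a ⟶ b) :
    mapArrow F f.1 = (F.map f).1 := by
  obtain ⟨f, rfl, rfl⟩ := f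
  rfl

theorem isFunctor_mapArrow (F : C.Carrier ⥤ C'.Carrier) : IsFunctor C C' F.obj (mapArrow F) where
  map_src f := (F.map (X := (C.src f : C.Carrier)) (Y := C.tgt f) ⟨f, rfl, rfl⟩).2.1
  map_tgt f := (F.map (X := (C.src f : C.Carrier)) (Y := C.tgt f) ⟨f, rfl, rfl⟩).2.2
  map_id a := (mapArrow_eq F (@CategoryStruct.id C.Carrier _ a)).trans (congrArg Subtype.val (F.map_id a))
  map_comp f g h h' := by
    let f' : @Quiver.Hom C.Carrier _ (C.src f) (C.tgt f) := ⟨f, rfl, rfl⟩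
    let g' : @Quiver.Hom C.Carrier _ (C.tgt f) (C.tgt g) := ⟨g, h.symm, rfl⟩
    refine (mapArrow_eq F (f' ≫ g')).trans ?_
    refine (congrArg Subtype.val (F.map_comp f' g')).trans ?_
    exact C'.comp_congr (mapArrow_eq F f').symm (mapArrow_eq F g').symm _ _

end CatStr

/-! ### Natural transformations between simplicial sets of paths. -/

namespace PathIn

variable {O A O' A' : Type u} {C : CatStr O A} {C' : CatStr O' A'}

section Natural

variable (φ : ∀ n, PathIn C n → PathIn C' n)
  (hφ : ∀ {m n} (θ : m ⟶ n) (p : PathIn C n), φ m (p.restrict θ) = (φ n p).restrict θ)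

include hφ

/-- Naturality along `[0] → [n]` here, and along `[1] → [n]` in `natural_map`, shows that `φ` is
determined by degrees 0 and 1. -/
theorem natural_obj {n : SimplexCategory} (p : PathIn C n) (i : Fin (n.len + 1)) :
    (φ n p).obj i = (φ _ (ofObj (p.obj i))).obj 0 := by
  have h := hφ (SimplexCategory.const (.mk 0) n i) p
  rw [eq_ofObj (p.restrict _)] at h
  exact (congrFun (congrArg obj h) 0).symm

theorem natural_map {n : SimplexCategory} (p : PathIn C n) (i j : Fin (n.len + 1)) (hij : i ≤ j) :
    (φ n p).map i j hij = (φ _ (ofArrow (p.map i j hij))).map 0 1 (Fin.zero_le _) := by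
  have h := hφ (SimplexCategory.mkOfLe (n := n.len) i j hij) p
  rw [eq_ofArrow (p.restrict _)] at h
  exact (congrFun (congrFun (congrFun (congrArg map h) 0) 1) (Fin.zero_le _)).symm

/-- A natural transformation between simplicial sets of paths comes from a functor. -/
theorem isFunctor_of_natural :
    IsFunctor C C' (fun a => (φ _ (ofObj a)).obj 0)
      (fun f => (φ _ (ofArrow f)).map 0 1 (Fin.zero_le _)) where
  map_src f := by
    rw [src_map, natural_obj φ hφ]
    rfl
  map_tgt f := by
    rw [tgt_map, natural_obj φ hφ]
    rfl
  map_id a := by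
    have h := natural_map φ hφ (ofObj (C := C) a) 0 0 le_rfl
    rw [map_id, map_id] at h
    exact h.symm
  map_comp f g h h' := by
    -- The image under `φ` of the 2-simplex on `f` and `g` has the images of `f`, `g` and their
    -- composite as its edges.
    have e := (φ _ (ofComposable f g h)).map_comp 0 1 2 (by decide) (by decide) (by decide)
      (by rw [tgt_map, src_map])
    rw [natural_map φ hφ _ 0 2] at e
    refine e.symm.trans ?_
    exact C'.comp_congr (natural_map φ hφ _ _ _ _) (natural_map φ hφ _ _ _ _) _ _

theorem natural_eq_mapFunctor {n : SimplexCategory} (p : PathIn C n) :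
    φ n p = p.mapFunctor (isFunctor_of_natural φ hφ) := by
  ext
  · exact natural_obj φ hφ _ _
  · exact natural_map φ hφ _ _ _ _

end Natural

end PathIn

/-! ### The horizontal nerve is fully faithful -/

namespace DblCat

variable {D E : DblCat.{u}}

/-- The action on objects of a natural transformation between horizontal nerves. -/
def nerveObj (α : D.nerve ⟶ E.nerve) (n : SimplexCategory) (p : PathIn D.hor n) : PathIn E.hor n :=
  (α.app (op n)).toFunctor.obj p

/-- The action on arrows of a natural transformation between horizontal nerves. -/
def nerveArrow (α : D.nerve ⟶ E.nerve) (n : SimplexCategory) (σ : PathIn D.horSq n) :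
    PathIn E.horSq n :=
  CatStr.mapArrow (C := D.nerveLevel n) (C' := E.nerveLevel n) (α.app (op n)).toFunctor σ

theorem nerveObj_restrict (α : D.nerve ⟶ E.nerve) {m n : SimplexCategory} (θ : m ⟶ n)
    (p : PathIn D.hor n) : nerveObj α m (p.restrict θ) = (nerveObj α n p).restrict θ :=
  congrArg (fun F => F.toFunctor.obj p) (α.naturality θ.op)

theorem nerveArrow_restrict (α : D.nerve ⟶ E.nerve) {m n : SimplexCategory} (θ : m ⟶ n)
    (σ : PathIn D.horSq n) : nerveArrow α m (σ.restrict θ) = (nerveArrow α n σ).restrict θ :=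
  congrArg (fun F : (D.nerveLevel n).Carrier ⥤ (E.nerveLevel m).Carrier => CatStr.mapArrow F σ)
    (congrArg Cat.Hom.toFunctor (α.naturality θ.op))

theorem isFunctor_nerveObj (α : D.nerve ⟶ E.nerve) (n : SimplexCategory) :
    IsFunctor (D.nerveLevel n) (E.nerveLevel n) (nerveObj α n) (nerveArrow α n) :=
  CatStr.isFunctor_mapArrow (α.app (op n)).toFunctor

theorem ofObj_nerve_composable {v w : D.Ver} (h : D.ver.tgt v = D.ver.src w) :
    (D.nerveLevel (.mk 0)).tgt (PathIn.ofObj v) = (D.nerveLevel (.mk 0)).src (PathIn.ofObj w) := by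
  rw [PathIn.eq_ofObj ((D.nerveLevel (.mk 0)).tgt _), PathIn.eq_ofObj ((D.nerveLevel (.mk 0)).src _)]
  exact congrArg _ h

theorem ofArrow_nerve_composable {α β : D.Sq} (h : D.verSq.tgt α = D.verSq.src β) :
    (D.nerveLevel (.mk 1)).tgt (PathIn.ofArrow α) =
      (D.nerveLevel (.mk 1)).src (PathIn.ofArrow β) := by
  rw [PathIn.eq_ofArrow ((D.nerveLevel (.mk 1)).tgt _),
    PathIn.eq_ofArrow ((D.nerveLevel (.mk 1)).src _)]
  exact congrArg _ h

/-- The double functor that induces a natural transformation between horizontal nerves. -/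
def ofNerveHom (α : D.nerve ⟶ E.nerve) : D ⟶ E where
  onObj a := (nerveObj α _ (PathIn.ofObj a)).obj 0
  onHor f := (nerveObj α _ (PathIn.ofArrow f)).map 0 1 (Fin.zero_le _)
  onVer v := (nerveArrow α _ (PathIn.ofObj v)).obj 0
  onSq s := (nerveArrow α _ (PathIn.ofArrow s)).map 0 1 (Fin.zero_le _)
  isFunctor_hor := PathIn.isFunctor_of_natural _ (nerveObj_restrict α)
  isFunctor_horSq := PathIn.isFunctor_of_natural _ (nerveArrow_restrict α)
  -- Horizontal functoriality comes from naturality in `Δ`; vertical functoriality comes from `α`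
  -- being a functor in degree 0 (vertical morphisms) and degree 1 (squares).
  isFunctor_ver :=
    { map_src v := by
        have h := (isFunctor_nerveObj α (.mk 0)).map_src (PathIn.ofObj v)
        rw [PathIn.natural_eq_mapFunctor _ (nerveObj_restrict α)] at h
        exact congrFun (congrArg PathIn.obj h) 0
      map_tgt v := by
        have h := (isFunctor_nerveObj α (.mk 0)).map_tgt (PathIn.ofObj v)
        rw [PathIn.natural_eq_mapFunctor _ (nerveObj_restrict α)] at h
        exact congrFun (congrArg PathIn.obj h) 0
      map_id a := by
        have h := (isFunctor_nerveObj α (.mk 0)).map_id (PathIn.ofObj a)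
        rw [PathIn.natural_eq_mapFunctor _ (nerveArrow_restrict α)] at h
        exact congrFun (congrArg PathIn.obj h) 0
      map_comp v w h h' := by
        have h := (isFunctor_nerveObj α (.mk 0)).map_comp (PathIn.ofObj v) (PathIn.ofObj w)
          (ofObj_nerve_composable h) (by
            rw [(isFunctor_nerveObj α _).map_tgt, (isFunctor_nerveObj α _).map_src,
              ofObj_nerve_composable h])
        rw [PathIn.natural_eq_mapFunctor _ (nerveArrow_restrict α)] at h
        exact congrFun (congrArg PathIn.obj h) 0 }
  isFunctor_verSq :=
    { map_src s := by
        have h := (isFunctor_nerveObj α (.mk 1)).map_src (PathIn.ofArrow s)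
        rw [PathIn.natural_eq_mapFunctor _ (nerveObj_restrict α)] at h
        exact congrFun (congrFun (congrFun (congrArg PathIn.map h) 0) 1) (Fin.zero_le 1)
      map_tgt s := by
        have h := (isFunctor_nerveObj α (.mk 1)).map_tgt (PathIn.ofArrow s)
        rw [PathIn.natural_eq_mapFunctor _ (nerveObj_restrict α)] at h
        exact congrFun (congrFun (congrFun (congrArg PathIn.map h) 0) 1) (Fin.zero_le 1)
      map_id f := by
        have h := (isFunctor_nerveObj α (.mk 1)).map_id (PathIn.ofArrow f)
        rw [PathIn.natural_eq_mapFunctor _ (nerveArrow_restrict α)] at h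
        exact congrFun (congrFun (congrFun (congrArg PathIn.map h) 0) 1) (Fin.zero_le 1)
      map_comp s t h h' := by
        have h := (isFunctor_nerveObj α (.mk 1)).map_comp (PathIn.ofArrow s) (PathIn.ofArrow t)
          (ofArrow_nerve_composable h) (by
            rw [(isFunctor_nerveObj α _).map_tgt, (isFunctor_nerveObj α _).map_src,
              ofArrow_nerve_composable h])
        rw [PathIn.natural_eq_mapFunctor _ (nerveArrow_restrict α)] at h
        exact congrFun (congrFun (congrFun (congrArg PathIn.map h) 0) 1) (Fin.zero_le 1) }

theorem nerve_map_ofNerveHom (α : D.nerve ⟶ E.nerve) : horizontalNerve.map (ofNerveHom α) = α := by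
  ext n : 2
  refine CatStr.functor_ext (C := E.nerveLevel n.unop) (fun p => ?_) fun {a b} f => ?_
  · exact (PathIn.natural_eq_mapFunctor _ (nerveObj_restrict α) p).symm
  · refine (PathIn.natural_eq_mapFunctor _ (nerveArrow_restrict α) f.1).symm.trans ?_
    exact CatStr.mapArrow_eq (C := D.nerveLevel n.unop) (C' := E.nerveLevel n.unop)
      (α.app n).toFunctor f

end DblCat

instance : horizontalNerve.{u}.Full where
  map_surjective α := ⟨_, DblCat.nerve_map_ofNerveHom α⟩

instance : horizontalNerve.{u}.Faithful where
  map_injective {D E} K L h := by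
    have hobj (n : SimplexCategory) (p : PathIn D.hor n) :
        DblCat.nerveObj (horizontalNerve.map K) n p = DblCat.nerveObj (horizontalNerve.map L) n p :=
      congrArg (fun α => DblCat.nerveObj α n p) h
    have harr (n : SimplexCategory) (p : PathIn D.horSq n) :
        DblCat.nerveArrow (horizontalNerve.map K) n p =
          DblCat.nerveArrow (horizontalNerve.map L) n p :=
      congrArg (fun α => DblCat.nerveArrow α n p) h
    refine DblFunctor.ext ?_ ?_ ?_ ?_ <;> funext x
    · exact congrFun (congrArg PathIn.obj (hobj _ (PathIn.ofObj x))) 0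
    · exact congrFun (congrFun (congrFun (congrArg PathIn.map (hobj _ (PathIn.ofArrow x))) 0) 1)
        (Fin.zero_le 1)
    · exact congrFun (congrArg PathIn.obj (harr _ (PathIn.ofObj x))) 0
    · exact congrFun (congrFun (congrFun (congrArg PathIn.map (harr _ (PathIn.ofArrow x))) 0) 1)
        (Fin.zero_le 1)

/-! ### Segal simplicial categories are horizontal nerves -/

/-- The arrows of the nerve form the simplicial set of paths in `D.horSq`, and the Segal condition
is detected on arrows. -/
theorem isSegal_horizontalNerve (D : DblCat.{u}) : isSegal (horizontalNerve.obj D) := by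
  refine isSegal_of_arrows (isSegal_of_iso ?_ (PathIn.isSegal_simplicialSet D.horSq))
  exact NatIso.ofComponents (fun n => (CatStr.arrowEquiv (D.nerveLevel n.unop)).symm.toIso)
    (fun θ => rfl)

instance : PreservesLimits Cat.objects.{u, u} := Cat.typeToCatObjectsAdj.rightAdjoint_preservesLimits

namespace DblCat

open SegalSet

variable {X : SimplexCategoryᵒᵖ ⥤ Cat.{u, u}}

theorem isSegal_objects (hX : isSegal X) : isSegal (X ⋙ Cat.objects) := isSegal_comp hX _

theorem isSegal_arrows (hX : isSegal X) : isSegal (X ⋙ catArrows) := isSegal_comp hX _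

/-- Source, target and identity of vertical arrows are natural in the simplicial degree, hence
functorial for horizontal composition. This lemma and the next two supply the axioms `top_comp`,
`bot_comp` and `comp_id` of `ofSegal`. -/
theorem isFunctor_left (hX : isSegal X) : IsFunctor (catStr (isSegal_arrows hX))
    (catStr (isSegal_objects hX)) (fun f => f.left) (fun f => f.left) :=
  isFunctor_catStr (isSegal_arrows hX) (isSegal_objects hX) (fun _ f => f.left) (fun _ _ => rfl)

theorem isFunctor_right (hX : isSegal X) : IsFunctor (catStr (isSegal_arrows hX))
    (catStr (isSegal_objects hX)) (fun f => f.right) (fun f => f.right) :=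
  isFunctor_catStr (isSegal_arrows hX) (isSegal_objects hX) (fun _ f => f.right) (fun _ _ => rfl)

theorem isFunctor_identity (hX : isSegal X) : IsFunctor (catStr (isSegal_objects hX))
    (catStr (isSegal_arrows hX)) (fun a => Arrow.mk (𝟙 a)) (fun a => Arrow.mk (𝟙 a)) :=
  isFunctor_catStr (isSegal_objects hX) (isSegal_arrows hX) (fun _ a => Arrow.mk (𝟙 a))
    (fun θ a => congrArg Arrow.mk ((X.map θ.op).toFunctor.map_id a).symm)

/-- The double category of a Segal simplicial category. -/
noncomputable def ofSegal (hX : isSegal X) : DblCat.{u} where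
  Obj := X.obj (op (.mk 0))
  Hor := X.obj (op (.mk 1))
  Ver := Arrow (X.obj (op (.mk 0)))
  Sq := Arrow (X.obj (op (.mk 1)))
  hor := catStr (isSegal_objects hX)
  ver := CatStr.ofCat _
  horSq := catStr (isSegal_arrows hX)
  verSq := CatStr.ofCat _
  isFunctor_src := CatStr.isFunctor_ofCat _
  isFunctor_tgt := CatStr.isFunctor_ofCat _
  isFunctor_id := CatStr.isFunctor_ofCat _
  top_comp := (isFunctor_left hX).map_comp
  bot_comp := (isFunctor_right hX).map_comp
  comp_id f g h h' := ((isFunctor_identity hX).map_comp f g h h').symm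
  interchange α β γ δ hαγ hβδ hαβ hγδ h h' := by
    -- The two horizontal pairs span triangles `x` and `y`, that is, arrows of `X_2`, composable
    -- because triangles of objects are unique. Restriction to an edge is a functor, so the vertical
    -- composite of `x` and `y` displays both sides.
    obtain ⟨x, rfl, rfl⟩ := exists_triangle (isSegal_arrows hX) α β hαβ
    obtain ⟨y, rfl, rfl⟩ := exists_triangle (isSegal_arrows hX) γ δ hγδ
    have hxy : (CatStr.ofCat (X.obj (op (.mk 2)))).tgt x = (CatStr.ofCat _).src y :=
      triangle_unique (isSegal_objects hX) hαγ hβδ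
    have e (i j : Fin 3) (hij : i ≤ j) (h) :
        edge (X ⋙ catArrows) ((CatStr.ofCat (X.obj (op (.mk 2)))).comp x y hxy) i j hij =
          (CatStr.ofCat (X.obj (op (.mk 1)))).comp (edge (X ⋙ catArrows) x i j hij)
            (edge (X ⋙ catArrows) y i j hij) h :=
      (CatStr.isFunctor_ofCat (X.map (SimplexCategory.mkOfLe i j hij).op).toFunctor).map_comp
        x y hxy h
    refine (comp_eq (isSegal_arrows hX) h _ 0 1 2 (by decide) (by decide)
      (e _ _ _ hαγ) (e _ _ _ hβδ)).trans ?_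
    have hxz := comp_edge (isSegal_arrows hX) x 0 1 2 (by decide) (by decide) hαβ
    have hyz := comp_edge (isSegal_arrows hX) y 0 1 2 (by decide) (by decide) hγδ
    refine (e 0 2 (by decide) (congrArg (X.map
      (SimplexCategory.mkOfLe (0 : Fin 3) 2 (by decide)).op).toFunctor.obj hxy)).trans ?_
    exact CatStr.comp_congr _ hxz.symm hyz.symm _ _

/-- The comparison of a Segal simplicial category with the nerve of its double category. -/
noncomputable def toNerveApp (hX : isSegal X) (n : SimplexCategory) :
    X.obj (op n) ⥤ ((ofSegal hX).nerveLevel n).Carrier where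
  obj x := toPath (isSegal_objects hX) x
  map f := ⟨toPath (isSegal_arrows hX) (Arrow.mk f), rfl, rfl⟩
  map_id x := Subtype.ext (by
    apply PathIn.ext
    · funext i
      exact congrArg Arrow.mk (CategoryTheory.Functor.map_id _ _)
    · funext i j h
      exact congrArg Arrow.mk (CategoryTheory.Functor.map_id _ _))
  map_comp f g := Subtype.ext (by
    apply PathIn.ext
    · funext i
      exact (congrArg Arrow.mk (CategoryTheory.Functor.map_comp _ f g)).trans
        (CatStr.ofCat_comp_mk _ _ _).symm
    · funext i j h
      exact (congrArg Arrow.mk (CategoryTheory.Functor.map_comp _ f g)).trans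
        (CatStr.ofCat_comp_mk _ _ _).symm)

/-- The comparison of a Segal simplicial category with the nerve of its double category. -/
noncomputable def toNerve (hX : isSegal X) : X ⟶ horizontalNerve.obj (ofSegal hX) where
  app n := (toNerveApp hX n.unop).toCatHom
  naturality _ _ θ := Cat.Hom.ext (CatStr.functor_ext
    (fun x => (restrict_toPath (isSegal_objects hX) θ.unop x).symm)
    (fun f => (restrict_toPath (isSegal_arrows hX) θ.unop (Arrow.mk f)).symm))

/-- An isomorphism of categories is detected on arrows, where the comparison is `toPath` for the
simplicial set of arrows. -/
instance (hX : isSegal X) : IsIso (toNerve hX) := by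
  rw [NatTrans.isIso_iff_isIso_app]
  intro n
  refine isIso_of_bijective_arrows _ ?_
  have h := toPath_bijective (isSegal_arrows hX) n.unop
  exact (Function.Bijective.of_comp_iff'
    (CatStr.arrowEquiv ((ofSegal hX).nerveLevel n.unop)).bijective _).1 h

end DblCat

theorem horizontalNerve_isRightAdjoint_and_presentable :
    horizontalNerve.{u}.IsRightAdjoint ∧ IsLocallyPresentable.{u} DblCat.{u} :=
  isRightAdjoint_and_presentable_of_essImage_eq_isSegal horizontalNerve.{u}
    isSegal_horizontalNerve
    (fun _ hX => ⟨DblCat.ofSegal hX, ⟨(asIso (DblCat.toNerve hX)).symm⟩⟩)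

/-! ### Lifting properties in the category of categories -/

section CatLifting

variable {A B : Cat.{u, u}}

/-- The free-living isomorphism. -/
abbrev walkingIso : Type u := AsSmall.{u} (Codiscrete (Fin 2))

namespace walkingIso

/-- The object `0`. -/
abbrev zero : walkingIso.{u} := AsSmall.up.obj ⟨0⟩

/-- The object `1`. -/
abbrev one : walkingIso.{u} := AsSmall.up.obj ⟨1⟩

instance (x y : walkingIso.{u}) : Unique (x ⟶ y) where
  default := ⟨⟨⟩⟩
  uniq _ := rfl

/-- Any two objects of the free-living isomorphism are isomorphic. -/
def iso (x y : walkingIso.{u}) : x ≅ y where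
  hom := default
  inv := default
  hom_inv_id := Subsingleton.elim _ _
  inv_hom_id := Subsingleton.elim _ _

theorem cases (x : walkingIso.{u}) : x = zero ∨ x = one := by
  obtain ⟨⟨x⟩⟩ := x
  fin_cases x
  · exact Or.inl rfl
  · exact Or.inr rfl

variable {C : Type*} [Category* C]

/-- The objects of the functor given by an isomorphism. -/
def objOfIso (x y : C) (i : walkingIso.{u}) : C :=
  ![x, y] (AsSmall.down.obj i).as

/-- The isomorphisms from the objects of the functor given by an isomorphism to the last one. -/
def isoToOne {x y : C} (e : x ≅ y) : ∀ i : walkingIso.{u}, objOfIso x y i ≅ y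
  | ⟨⟨0⟩⟩ => e
  | ⟨⟨1⟩⟩ => Iso.refl y

/-- The functor from the free-living isomorphism given by an isomorphism. -/
def ofIso {x y : C} (e : x ≅ y) : walkingIso.{u} ⥤ C where
  obj := objOfIso x y
  -- Every arrow is routed through the last object `y`, so functoriality is cancellation of an
  -- isomorphism against its inverse.
  map {i j} _ := (isoToOne e i).hom ≫ (isoToOne e j).inv

theorem ofIso_map {x y : C} (e : x ≅ y) :
    (ofIso.{u} e).map (iso zero one).hom = e.hom := by
  exact Category.comp_id _

theorem functor_ext {F G : walkingIso.{u} ⥤ C} (h₀ : F.obj zero = G.obj zero)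
    (h₁ : F.obj one = G.obj one)
    (h : F.map (iso zero one).hom = eqToHom h₀ ≫ G.map (iso zero one).hom ≫ eqToHom h₁.symm) :
    F = G := by
  have hinv : F.map (iso zero one).inv =
      eqToHom h₁ ≫ G.map (iso zero one).inv ≫ eqToHom h₀.symm := by
    rw [← cancel_epi (F.map (iso zero one).hom), ← F.map_comp, Iso.hom_inv_id, h]
    simp [← G.map_comp_assoc]
  have hobj : ∀ i, F.obj i = G.obj i := by
    intro i
    obtain rfl | rfl := cases i
    exacts [h₀, h₁]
  refine CategoryTheory.Functor.ext hobj fun i j f => ?_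
  obtain rfl | rfl := cases i <;> obtain rfl | rfl := cases j
  · obtain rfl : f = 𝟙 _ := Subsingleton.elim _ _
    simp
  · obtain rfl : f = (iso zero one).hom := Subsingleton.elim _ _
    exact h
  · obtain rfl : f = (iso zero one).inv := Subsingleton.elim _ _
    exact hinv
  · obtain rfl : f = 𝟙 _ := Subsingleton.elim _ _
    simp

end walkingIso

theorem catHom_ext_of_point {F G : Cat.of (AsSmall.{u} (Discrete Unit)) ⟶ A}
    (h : F.toFunctor.obj (AsSmall.up.obj ⟨()⟩) = G.toFunctor.obj (AsSmall.up.obj ⟨()⟩)) : F = G := by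
  refine Cat.Hom.ext (CategoryTheory.Functor.ext (fun _ => h) ?_)
  rintro ⟨⟨⟨⟩⟩⟩ ⟨⟨⟨⟩⟩⟩ f
  obtain rfl : f = 𝟙 _ := rfl
  refine (F.toFunctor.map_id _).trans ?_
  refine Eq.trans ?_ (congrArg (fun k => eqToHom _ ≫ k ≫ eqToHom _) (G.toFunctor.map_id _)).symm
  rw [Category.id_comp]
  exact (eqToHom_trans h h.symm).symm

/-- The point sits at the object 1, the target of the free isomorphism, so a lifting problem is an
object `a` with an isomorphism ending at `p a`. -/
theorem hasLiftingProperty_pointToIso_iff (p : A ⟶ B) :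
    HasLiftingProperty (liftFunctor.{u} pointToIso) p ↔ catIsofibrations p := by
  constructor
  · intro hp a b g
    have sq : CommSq (((Functor.const _).obj a).toCatHom :
        Cat.of (AsSmall.{u} (Discrete Unit)) ⟶ A) (liftFunctor.{u} pointToIso) p
        (walkingIso.ofIso.{u} g).toCatHom := ⟨catHom_ext_of_point rfl⟩
    obtain ⟨l⟩ := (hp.sq_hasLift sq).exists_lift
    have e₁ : l.l.toFunctor.obj walkingIso.one = a :=
      congrArg (fun F => F.toFunctor.obj (AsSmall.up.obj ⟨()⟩)) l.fac_left
    have e₂ := congrArg Cat.Hom.toFunctor l.fac_right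
    have e₃ := Functor.congr_hom e₂ (walkingIso.iso walkingIso.zero walkingIso.one).hom
    refine ⟨l.l.toFunctor.obj walkingIso.zero,
      l.l.toFunctor.mapIso (walkingIso.iso _ _) ≪≫ eqToIso e₁,
      Functor.congr_obj e₂ walkingIso.zero, ?_⟩
    refine (p.toFunctor.map_comp _ _).trans ?_
    refine (congrArg (· ≫ _) e₃).trans ?_
    have e₄ := walkingIso.ofIso_map.{u} g
    refine (congrArg (fun k => (eqToHom _ ≫ k ≫ eqToHom _) ≫ p.toFunctor.map (eqToIso e₁).hom)
      e₄).trans ?_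
    rw [eqToIso.hom, eqToHom_map, Category.assoc]
    refine congrArg (eqToHom _ ≫ ·) ((Category.assoc _ _ _).trans ?_)
    refine (congrArg (g.hom ≫ ·) (eqToHom_trans _ _)).trans ?_
    exact Category.comp_id _
  · intro hp
    constructor
    intro t s sq
    let a := t.toFunctor.obj (AsSmall.up.obj ⟨()⟩)
    have ha : s.toFunctor.obj walkingIso.one = p.toFunctor.obj a :=
      (congrArg (fun F => F.toFunctor.obj (AsSmall.up.obj ⟨()⟩)) sq.w).symm
    obtain ⟨a', f, h, hf⟩ := hp a _
      (s.toFunctor.mapIso (walkingIso.iso walkingIso.zero _) ≪≫ eqToIso ha)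
    refine ⟨⟨(walkingIso.ofIso.{u} f).toCatHom, catHom_ext_of_point rfl, ?_⟩⟩
    refine Cat.Hom.ext (walkingIso.functor_ext h ha.symm ?_)
    exact (congrArg p.toFunctor.map (walkingIso.ofIso_map.{u} f)).trans hf

theorem catGenAcyclicCof_rlp : catGenAcyclicCof.{u}.rlp = catIsofibrations := by
  ext A B p
  rw [← hasLiftingProperty_pointToIso_iff]
  constructor
  · intro h
    exact h _ .pointToIso
  · rintro h _ _ _ ⟨⟩
    exact h

theorem hasLiftingProperty_emptyToPoint_iff (p : A ⟶ B) :
    HasLiftingProperty (liftFunctor.{u} emptyToPoint) p ↔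
      Function.Surjective p.toFunctor.obj := by
  have ext (C : Cat.{u, u}) (F G : Cat.of (AsSmall.{u} (Discrete PEmpty.{1})) ⟶ C) : F = G :=
    Cat.Hom.ext (CategoryTheory.Functor.ext (fun i => (AsSmall.down.obj i).as.elim)
      fun i => (AsSmall.down.obj i).as.elim)
  constructor
  · intro hp b
    have sq : CommSq ((AsSmall.down ⋙ Functor.empty _).toCatHom :
        Cat.of (AsSmall.{u} (Discrete PEmpty.{1})) ⟶ A) (liftFunctor.{u} emptyToPoint) p
        (((Functor.const _).obj b).toCatHom) := ⟨ext _ _ _⟩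
    obtain ⟨l⟩ := (hp.sq_hasLift sq).exists_lift
    exact ⟨l.l.toFunctor.obj (AsSmall.up.obj ⟨()⟩),
      congrArg (fun F => F.toFunctor.obj (AsSmall.up.obj ⟨()⟩)) l.fac_right⟩
  · intro hp
    constructor
    intro t s sq
    obtain ⟨a, ha⟩ := hp (s.toFunctor.obj (AsSmall.up.obj ⟨()⟩))
    exact ⟨⟨((Functor.const _).obj a).toCatHom, ext _ _ _, catHom_ext_of_point ha⟩⟩

theorem catHom_ext_of_pair {F G : Cat.of (AsSmall.{u} (Discrete (Fin 2))) ⟶ A}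
    (h₀ : F.toFunctor.obj (AsSmall.up.obj ⟨0⟩) = G.toFunctor.obj (AsSmall.up.obj ⟨0⟩))
    (h₁ : F.toFunctor.obj (AsSmall.up.obj ⟨1⟩) = G.toFunctor.obj (AsSmall.up.obj ⟨1⟩)) : F = G := by
  refine Cat.Hom.ext (CategoryTheory.Functor.ext (fun ⟨⟨i⟩⟩ => ?_) ?_)
  · fin_cases i
    exacts [h₀, h₁]
  · rintro ⟨⟨i⟩⟩ ⟨⟨j⟩⟩ f
    obtain rfl : i = j := f.down.down.down
    obtain rfl : f = 𝟙 _ := rfl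
    refine (F.toFunctor.map_id _).trans ?_
    refine Eq.trans ?_ (congrArg (fun k => eqToHom _ ≫ k ≫ eqToHom _) (G.toFunctor.map_id _)).symm
    simp

/-- The nontrivial arrow of the free-living arrow. -/
abbrev walkingArrowHom : (AsSmall.up.obj 0 : AsSmall.{u} (Fin 2)) ⟶ AsSmall.up.obj 1 :=
  AsSmall.up.map (homOfLE (Fin.zero_le 1 : (0 : Fin 2) ≤ 1))

theorem hasLiftingProperty_endpoints_iff (p : A ⟶ B) :
    HasLiftingProperty (liftFunctor.{u} endpoints) p ↔ p.toFunctor.Full := by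
  constructor
  · intro hp
    refine ⟨fun {a b} g => ?_⟩
    have sq : CommSq ((AsSmall.down ⋙ Discrete.functor ![a, b]).toCatHom :
        Cat.of (AsSmall.{u} (Discrete (Fin 2))) ⟶ A) (liftFunctor.{u} endpoints) p
        ((walkingArrowEquiv B).symm (Arrow.mk g)) := ⟨catHom_ext_of_pair rfl rfl⟩
    obtain ⟨l⟩ := (hp.sq_hasLift sq).exists_lift
    let f := walkingArrowEquiv A l.l
    have hf : p.toFunctor.mapArrow.obj f = Arrow.mk g :=
      (congrArg (walkingArrowEquiv B) l.fac_right).trans (Equiv.apply_symm_apply _ _)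
    have h₀ : f.left = a := congrArg (fun F => F.toFunctor.obj (AsSmall.up.obj ⟨0⟩)) l.fac_left
    have h₁ : f.right = b := congrArg (fun F => F.toFunctor.obj (AsSmall.up.obj ⟨1⟩)) l.fac_left
    -- The endpoints of `f` agree with `a` and `b` only propositionally; forgetting the value of `f`
    -- permits substitution.
    clear_value f
    obtain ⟨a', b', f⟩ := f
    subst h₀ h₁
    exact ⟨f, Arrow.mk_injective _ _ hf⟩
  · intro hp
    constructor
    intro t s sq
    have h₀ : p.toFunctor.obj (t.toFunctor.obj (AsSmall.up.obj ⟨0⟩)) =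
        s.toFunctor.obj (AsSmall.up.obj 0) :=
      congrArg (fun F => F.toFunctor.obj (AsSmall.up.obj ⟨0⟩)) sq.w
    have h₁ : p.toFunctor.obj (t.toFunctor.obj (AsSmall.up.obj ⟨1⟩)) =
        s.toFunctor.obj (AsSmall.up.obj 1) :=
      congrArg (fun F => F.toFunctor.obj (AsSmall.up.obj ⟨1⟩)) sq.w
    let f := p.toFunctor.preimage
      (eqToHom h₀ ≫ s.toFunctor.map walkingArrowHom ≫ eqToHom h₁.symm)
    refine ⟨⟨(walkingArrowEquiv A).symm (Arrow.mk f), catHom_ext_of_pair rfl rfl, ?_⟩⟩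
    apply (walkingArrowEquiv B).injective
    exact (Arrow.mk_eq_mk_iff _ _).2 ⟨h₀, h₁, p.toFunctor.map_preimage _⟩

theorem catHom_ext_of_parallel {F G : Cat.of (AsSmall.{u} WalkingParallelPair) ⟶ A}
    (h₁ : Arrow.mk (F.toFunctor.map (AsSmall.up.map .left)) =
      Arrow.mk (G.toFunctor.map (AsSmall.up.map .left)))
    (h₂ : Arrow.mk (F.toFunctor.map (AsSmall.up.map .right)) =
      Arrow.mk (G.toFunctor.map (AsSmall.up.map .right))) : F = G := by
  refine Cat.Hom.ext (CategoryTheory.Functor.ext (fun ⟨i⟩ => ?_) ?_)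
  · cases i
    exacts [congrArg Comma.left h₁, congrArg Comma.right h₁]
  · rintro ⟨i⟩ ⟨j⟩ ⟨f⟩
    change WalkingParallelPairHom i j at f
    cases f
    · exact ((Arrow.mk_eq_mk_iff _ _).1 h₁).2.2
    · exact ((Arrow.mk_eq_mk_iff _ _).1 h₂).2.2
    · refine (F.toFunctor.map_id _).trans ?_
      refine Eq.trans ?_ (congrArg (fun k => eqToHom _ ≫ k ≫ eqToHom _) (G.toFunctor.map_id _)).symm
      simp

theorem hasLiftingProperty_parallelToArrow_iff (p : A ⟶ B) :
    HasLiftingProperty (liftFunctor.{u} parallelToArrow) p ↔ p.toFunctor.Faithful := by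
  constructor
  · intro hp
    refine ⟨fun {a b f g} hfg => ?_⟩
    have sq : CommSq ((AsSmall.down ⋙ parallelPair f g).toCatHom :
        Cat.of (AsSmall.{u} WalkingParallelPair) ⟶ A) (liftFunctor.{u} parallelToArrow) p
        ((walkingArrowEquiv B).symm (Arrow.mk (p.toFunctor.map f))) :=
      ⟨catHom_ext_of_parallel rfl (congrArg Arrow.mk hfg.symm)⟩
    obtain ⟨l⟩ := (hp.sq_hasLift sq).exists_lift
    have h₁ : walkingArrowEquiv A l.l = Arrow.mk f :=
      congrArg (fun F : Cat.of (AsSmall.{u} WalkingParallelPair) ⟶ A =>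
        Arrow.mk (F.toFunctor.map (AsSmall.up.map WalkingParallelPairHom.left))) l.fac_left
    have h₂ : walkingArrowEquiv A l.l = Arrow.mk g :=
      congrArg (fun F : Cat.of (AsSmall.{u} WalkingParallelPair) ⟶ A =>
        Arrow.mk (F.toFunctor.map (AsSmall.up.map WalkingParallelPairHom.right))) l.fac_left
    exact Arrow.mk_injective _ _ (h₁.symm.trans h₂)
  · intro hp
    constructor
    intro t s sq
    have h₁ : Arrow.mk (p.toFunctor.map (t.toFunctor.map (AsSmall.up.map .left))) =
        walkingArrowEquiv B s :=
      congrArg (fun F => Arrow.mk (F.toFunctor.map (AsSmall.up.map .left))) sq.w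
    have h₂ : Arrow.mk (p.toFunctor.map (t.toFunctor.map (AsSmall.up.map .right))) =
        walkingArrowEquiv B s :=
      congrArg (fun F => Arrow.mk (F.toFunctor.map (AsSmall.up.map .right))) sq.w
    have h₃ : t.toFunctor.map (AsSmall.up.map WalkingParallelPairHom.left) =
        t.toFunctor.map (AsSmall.up.map WalkingParallelPairHom.right) :=
      p.toFunctor.map_injective (Arrow.mk_injective _ _ (h₁.trans h₂.symm))
    refine ⟨⟨(walkingArrowEquiv A).symm
      (Arrow.mk (t.toFunctor.map (AsSmall.up.map .left))), catHom_ext_of_parallel rfl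
        (congrArg Arrow.mk h₃), ?_⟩⟩
    exact (walkingArrowEquiv B).injective h₁

/-- The three generators test surjectivity on objects, fullness and faithfulness. Full faithfulness
and surjectivity lift isomorphisms; conversely, an isofibration turns a preimage up to isomorphism
into a strict one. -/
theorem catGenCof_rlp : catGenCof.{u}.rlp = catIsofibrations ⊓ catEquivalences := by
  ext A B p
  have h : catGenCof.{u}.rlp p ↔
      Function.Surjective p.toFunctor.obj ∧ p.toFunctor.Full ∧ p.toFunctor.Faithful := by
    rw [← hasLiftingProperty_emptyToPoint_iff, ← hasLiftingProperty_endpoints_iff,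
      ← hasLiftingProperty_parallelToArrow_iff]
    constructor
    · intro h
      exact ⟨h _ .emptyToPoint, h _ .endpoints, h _ .parallelToArrow⟩
    · rintro ⟨h₁, h₂, h₃⟩ _ _ _ ⟨⟩
      exacts [h₁, h₂, h₃]
  rw [h]
  constructor
  · rintro ⟨hs, _, _⟩
    constructor
    · intro a b g
      obtain ⟨a', rfl⟩ := hs b
      exact ⟨a', p.toFunctor.preimageIso g, rfl, by simp⟩
    · have : p.toFunctor.EssSurj := ⟨fun b => by
        obtain ⟨a, rfl⟩ := hs b
        exact ⟨a, ⟨Iso.refl _⟩⟩⟩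
      exact { }
  · rintro ⟨hi, he⟩
    have : p.toFunctor.IsEquivalence := he
    refine ⟨fun b => ?_, inferInstance, inferInstance⟩
    obtain ⟨a', -, h, -⟩ := hi _ b (p.toFunctor.objObjPreimageIso b).symm
    exact ⟨a', h⟩

end CatLifting

/-! ### Cofibrantly generated model structures on locally presentable categories -/

section Recognition

variable {C : Type u} [Category.{v} C]

theorem isCardinalFiltered_of_isOrdinalFiltered (κ : Cardinal.{w}) [Fact κ.IsRegular]
    (J : Type w) [LinearOrder J] (hJ : IsOrdinalFiltered κ J) : IsCardinalFiltered J κ :=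
  isCardinalFiltered_preorder _ _ fun K s hK => by
    obtain ⟨j, hj⟩ := hJ.2 (Set.range s) (Cardinal.mk_range_le.trans hK.le)
    exact ⟨j, fun k => hj ⟨k, rfl⟩⟩

theorem isSmallRelativeTo_of_isPresentable (A : C) [IsPresentable.{w} A]
    (W : MorphismProperty C) : IsSmallRelativeTo.{w} A W := by
  obtain ⟨κ, _, _⟩ := Functor.IsAccessible.exists_cardinal.{w} (F := coyoneda.obj (op A))
  refine ⟨κ, fun J _ _ _ _ hJ X _ _ => ?_⟩
  have := isCardinalFiltered_of_isOrdinalFiltered κ J hJ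
  have : IsCardinalPresentable A κ := ‹_›
  have := preservesColimitsOfShape_of_isCardinalPresentable A κ J
  infer_instance

/-- Since `I` is a set, one regular cardinal dominates the presentability ranks of all domains, and
sequences of that length serve for the small object argument. -/
theorem hasSmallObjectArgument_of_isLocallyPresentable [LocallySmall.{w} C]
    [IsLocallyPresentable.{w} C] [HasColimitsOfSize.{w, w} C] (I : MorphismProperty C)
    [MorphismProperty.IsSmall.{w} I] : 
    MorphismProperty.HasSmallObjectArgument.{w} I := by
  obtain ⟨ι, A, B, f, rfl⟩ := (MorphismProperty.isSmall_iff_eq_ofHoms.{w} I).1 inferInstance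
  choose κ hκ hA using fun i =>
    Functor.IsAccessible.exists_cardinal.{w} (F := coyoneda.obj (op (A i)))
  obtain ⟨κ', hκ', h⟩ := HasCardinalLT.exists_regular_cardinal_forall.{w}
    fun i => (κ i).ord.ToType
  have : Fact κ'.IsRegular := ⟨hκ'⟩
  have hle (i : ι) : κ i ≤ κ' :=
    le_of_lt (by simpa [hasCardinalLT_iff_cardinal_mk_lt] using h i)
  have : Nonempty κ'.ord.ToType := by simpa using hκ'.ne_zero
  have := WellFoundedLT.toOrderBot κ'.ord.ToType
  exact ⟨κ', inferInstance, inferInstance,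
    { preservesColimit := by
        rintro _ _ _ _ _ ⟨i⟩ _ hf
        have : IsCardinalPresentable (A i) (κ i) := hA i
        have : IsCardinalPresentable (A i) κ' := isCardinalPresentable_of_le _ (hle i)
        have := preservesColimitsOfShape_of_isCardinalPresentable (A i) κ' κ'.ord.ToType
        infer_instance }⟩

theorem exists_modelCategory [IsLocallyPresentable.{w} C] [LocallySmall.{w} C]
    [HasLimitsOfSize.{w, w} C] [HasColimitsOfSize.{w, w} C] (I J W : MorphismProperty C)
    [MorphismProperty.IsSmall.{w} I] [MorphismProperty.IsSmall.{w} J]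
    [W.HasTwoOutOfThreeProperty] (hIJ : I.rlp = J.rlp ⊓ W) (hJ : J.rlp.llp ≤ W) :
    ∃ _ : ModelCategory C, weakEquivalences C = W ∧ fibrations C = J.rlp ∧
      IsCofibrantlyGeneratedBy.{w} C I J := by
  have := hasSmallObjectArgument_of_isLocallyPresentable.{w} I
  have := hasSmallObjectArgument_of_isLocallyPresentable.{w} J
  have hIJ' : J.rlp.llp ≤ I.rlp.llp :=
    MorphismProperty.antitone_llp (hIJ.trans_le inf_le_left)
  -- Retract argument: factor `f` through `llp (rlp J)` and `rlp J`. By two-out-of-three the second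
  -- factor lies in `W`, hence in `rlp I`, so `f` lifts against it and is a retract of the first
  -- factor.
  have hcof : I.rlp.llp ⊓ W = J.rlp.llp := by
    refine le_antisymm ?_ (le_inf hIJ' hJ)
    rintro A B f ⟨hf, hfW⟩
    let h := MorphismProperty.factorizationData J.rlp.llp J.rlp f
    have hp : I.rlp h.p := by
      rw [hIJ]
      exact ⟨h.hp, W.of_precomp h.i h.p (hJ _ h.hi) (by rwa [h.fac])⟩
    have := hf _ hp
    exact MorphismProperty.of_retract (RetractArrow.ofLeftLiftingProperty h.fac) h.hi
  let : CategoryWithWeakEquivalences C := ⟨W⟩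
  let : CategoryWithFibrations C := ⟨J.rlp⟩
  let : CategoryWithCofibrations C := ⟨I.rlp.llp⟩
  have htf : trivialFibrations C = I.rlp := hIJ.symm
  have htc : trivialCofibrations C = J.rlp.llp := hcof
  have : (weakEquivalences C).HasTwoOutOfThreeProperty := ‹W.HasTwoOutOfThreeProperty›
  have : MorphismProperty.IsWeakFactorizationSystem (cofibrations C) (trivialFibrations C) := by
    rw [htf]
    exact .mk' I.rlp.llp I.rlp fun i p hi hp => hi _ hp
  have : MorphismProperty.IsWeakFactorizationSystem (trivialCofibrations C) (fibrations C) := by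
    rw [htc]
    exact .mk' J.rlp.llp J.rlp fun i p hi hp => hi _ hp
  have : HasFiniteLimits C := hasFiniteLimits_of_hasLimitsOfSize.{w, w} C
  have : HasFiniteColimits C := hasFiniteColimits_of_hasColimitsOfSize.{w, w} C
  let : ModelCategory C := ModelCategory.mk' C
  exact ⟨inferInstance, rfl, rfl,
    { hasLimits := inferInstance
      hasColimits := inferInstance
      isSet_I := inferInstance
      isSet_J := inferInstance
      small_I := fun _ _ => isSmallRelativeTo_of_isPresentable _ _
      small_J := fun _ _ => isSmallRelativeTo_of_isPresentable _ _
      fibrations_eq := rfl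
      trivialFibrations_eq := htf }⟩

end Recognition

/-! ### Path objects of categories -/

section Paths

/-- The category of isomorphisms of a category. -/
abbrev catPath : Cat.{u, u} ⥤ Cat.{u, u} := Cat.exp walkingIso.{u}

/-- Limit preservation is what keeps the Segal condition under passage to path objects. -/
instance : PreservesLimitsOfSize.{w, w} catPath.{u} :=
  ((Cat.closed walkingIso.{u}).adj).rightAdjoint_preservesLimits

namespace catPath

/-- The evaluation of an isomorphism at an endpoint. -/
def ev (i : walkingIso.{u}) : catPath.{u} ⟶ 𝟭 Cat.{u, u} where
  app X := ((evaluation _ X).obj i).toCatHom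

/-- The identity isomorphisms. -/
def const : 𝟭 Cat.{u, u} ⟶ catPath.{u} where
  app X := (Functor.const walkingIso.{u}).toCatHom
  naturality X Y f := by
    refine Cat.Hom.ext (CategoryTheory.Functor.ext (fun x => ?_) fun x y g => ?_)
    · exact CategoryTheory.Functor.ext (fun _ => rfl) fun _ _ _ =>
        (f.toFunctor.map_id x).symm.trans ((Category.id_comp _).trans (Category.comp_id _)).symm
    · refine NatTrans.ext (funext fun (i : walkingIso.{u}) => ?_)
      refine Eq.trans ?_ (congrArg₂ (fun a b => a ≫ f.toFunctor.map g ≫ b)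
        (eqToHom_app _ i) (eqToHom_app _ i)).symm
      exact ((Category.id_comp _).trans (Category.comp_id _)).symm

variable {X Y : Cat.{u, u}}

/-- The source and the target of an isomorphism. -/
def endpoints (X : Cat.{u, u}) : catPath.obj X ⟶ Cat.of (X × X) :=
  (((evaluation _ X).obj walkingIso.zero).prod' ((evaluation _ X).obj walkingIso.one)).toCatHom

/-- Replacing the two objects of `a` along the given isomorphisms yields an isomorphic functor whose
endpoints are `b₀` and `b₁` on the nose. -/
theorem endpoints_isofibration (X : Cat.{u, u}) : catIsofibrations (endpoints X) := by
  rintro (a : walkingIso.{u} ⥤ X) ⟨b₀, b₁⟩ g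
  let g₀ : b₀ ≅ a.obj walkingIso.zero := (CategoryTheory.Prod.fst X X).mapIso g
  let g₁ : b₁ ≅ a.obj walkingIso.one := (CategoryTheory.Prod.snd X X).mapIso g
  let e : ∀ i, a.obj i ≅ walkingIso.objOfIso b₀ b₁ i
    | ⟨⟨0⟩⟩ => g₀.symm
    | ⟨⟨1⟩⟩ => g₁.symm
  refine ⟨a.copyObj _ e, (a.isoCopyObj _ e).symm, rfl, ?_⟩
  exact (Category.id_comp g.hom).symm

/-- The lifting property of `endpoints X` against the point of the free isomorphism is put
componentwise, so that it also serves products other than `X × X`, such as images of products under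
`N`. -/
theorem exists_lift (t : Cat.of (AsSmall.{u} (Discrete Unit)) ⟶ catPath.obj X)
    (s₀ s₁ : Cat.of walkingIso.{u} ⟶ X)
    (h₀ : t ≫ (ev walkingIso.zero).app X = liftFunctor.{u} pointToIso ≫ s₀)
    (h₁ : t ≫ (ev walkingIso.one).app X = liftFunctor.{u} pointToIso ≫ s₁) :
    ∃ l : Cat.of walkingIso.{u} ⟶ catPath.obj X, liftFunctor.{u} pointToIso ≫ l = t ∧
      l ≫ (ev walkingIso.zero).app X = s₀ ∧ l ≫ (ev walkingIso.one).app X = s₁ := by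
  have sq : CommSq t (liftFunctor.{u} pointToIso) (endpoints X)
      (s₀.toFunctor.prod' s₁.toFunctor).toCatHom := ⟨catHom_ext_of_point
        (Prod.ext (congrArg (fun F => F.toFunctor.obj (AsSmall.up.obj ⟨()⟩)) h₀)
          (congrArg (fun F => F.toFunctor.obj (AsSmall.up.obj ⟨()⟩)) h₁))⟩
  obtain ⟨l⟩ := (((hasLiftingProperty_pointToIso_iff _).2
    (endpoints_isofibration X)).sq_hasLift sq).exists_lift
  exact ⟨l.l, l.fac_left,
    congrArg (fun F => Cat.Hom.ofFunctor (F.toFunctor ⋙ CategoryTheory.Prod.fst X X)) l.fac_right,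
    congrArg (fun F => Cat.Hom.ofFunctor (F.toFunctor ⋙ CategoryTheory.Prod.snd X X)) l.fac_right⟩

/-- The evaluations at the two endpoints are isomorphic. -/
def evIso (X : Cat.{u, u}) :
    ((ev walkingIso.zero).app X).toFunctor ≅ ((ev walkingIso.one).app X).toFunctor :=
  (evaluation walkingIso.{u} X).mapIso (walkingIso.iso _ _)

/-- `H` encodes a natural isomorphism between the identity and `r ≫ j`, so `r` is a quasi-inverse of
`j`. -/
theorem isEquivalence_of_homotopy (j : X ⟶ Y) (r : Y ⟶ X) (h : j ≫ r = 𝟙 X)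
    (H : Y ⟶ catPath.obj Y) (h₀ : H ≫ (ev walkingIso.zero).app Y = 𝟙 Y)
    (h₁ : H ≫ (ev walkingIso.one).app Y = r ≫ j) : catEquivalences j :=
  (CategoryTheory.Equivalence.mk j.toFunctor r.toFunctor
    (eqToIso (congrArg Cat.Hom.toFunctor h.symm))
    (eqToIso (congrArg Cat.Hom.toFunctor h₁.symm) ≪≫
      (Functor.isoWhiskerLeft H.toFunctor (evIso Y)).symm ≪≫
      eqToIso (congrArg Cat.Hom.toFunctor h₀))).isEquivalence_functor

end catPath

end Paths

/-! ### Transfer along a fully faithful right adjoint -/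

section Transfer

variable {C : Type w} [Category.{v} C]

theorem isSmall_strictMap {D : Type*} [Category* D] (S : MorphismProperty C) (F : C ⥤ D)
    [MorphismProperty.IsSmall.{u} S] : MorphismProperty.IsSmall.{u} (S.strictMap F) where
  small_toSet := by
    refine small_of_surjective (α := S.toSet)
      (f := fun f => ⟨Arrow.mk (F.map f.1.hom), ⟨f.2⟩⟩) ?_
    rintro ⟨⟨_, _, _⟩, ⟨hf⟩⟩
    exact ⟨⟨Arrow.mk _, hf⟩, rfl⟩

theorem isSmall_diagramGen (S : MorphismProperty Cat.{u, u}) [MorphismProperty.IsSmall.{u} S] :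
    MorphismProperty.IsSmall.{u} (diagramGen S) where
  small_toSet := by
    refine small_of_surjective (α := SimplexCategoryᵒᵖ × S.toSet)
      (f := fun f => ⟨Arrow.mk ((evaluationLeftAdjoint _ f.1).map f.2.1.hom), ⟨f.1, _, f.2.2⟩⟩) ?_
    rintro ⟨⟨_, _, _⟩, ⟨n, f, hf⟩⟩
    exact ⟨⟨n, Arrow.mk _, hf⟩, rfl⟩

instance : MorphismProperty.IsSmall.{u} catGenCof.{u} where
  small_toSet := by
    refine small_of_surjective.{u} (α := Fin 3) (f := (![⟨Arrow.mk _, .emptyToPoint⟩,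
      ⟨Arrow.mk _, .endpoints⟩, ⟨Arrow.mk _, .parallelToArrow⟩] : _ → catGenCof.{u}.toSet)) ?_
    rintro ⟨⟨_, _, _⟩, ⟨⟩⟩
    exacts [⟨0, rfl⟩, ⟨1, rfl⟩, ⟨2, rfl⟩]

instance : MorphismProperty.IsSmall.{u} catGenAcyclicCof.{u} where
  small_toSet := by
    refine small_of_surjective.{u} (α := Unit)
      (f := fun _ => (⟨Arrow.mk _, .pointToIso⟩ : catGenAcyclicCof.{u}.toSet)) ?_
    rintro ⟨⟨_, _, _⟩, ⟨⟩⟩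
    exact ⟨(), rfl⟩

theorem diagramGen_rlp_iff (S : MorphismProperty Cat.{u, u}) {X Y : SimplexCategoryᵒᵖ ⥤ Cat.{u, u}}
    (α : X ⟶ Y) : (diagramGen S).rlp α ↔ ∀ n, S.rlp (α.app n) := by
  constructor
  · intro h n A B f hf
    exact ((evaluationAdjunctionRight Cat.{u, u} n).hasLiftingProperty_iff f α).1 (h _ ⟨n, f, hf⟩)
  · rintro h _ _ _ ⟨n, f, hf⟩
    exact ((evaluationAdjunctionRight Cat.{u, u} n).hasLiftingProperty_iff f α).2 (h n _ hf)

theorem strictMap_rlp_iff {D : Type*} [Category* D] (S : MorphismProperty D) {L : D ⥤ C}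
    {N : C ⥤ D} (adj : L ⊣ N) {X Y : C} (p : X ⟶ Y) :
    (S.strictMap L).rlp p ↔ S.rlp (N.map p) := by
  constructor
  · intro h A B f hf
    exact (adj.hasLiftingProperty_iff f p).1 (h _ ⟨hf⟩)
  · rintro h _ _ _ ⟨hf⟩
    exact (adj.hasLiftingProperty_iff _ p).2 (h _ hf)

/-- The morphisms sent to levelwise equivalences of categories. -/
def levelwiseEquivalences (N : C ⥤ SimplexCategoryᵒᵖ ⥤ Cat.{u, u}) : MorphismProperty C :=
  fun _ _ f => ∀ n, catEquivalences ((N.map f).app n)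

instance : catEquivalences.{u}.HasTwoOutOfThreeProperty where
  comp_mem f g hf hg := by
    have : f.toFunctor.IsEquivalence := hf
    have : g.toFunctor.IsEquivalence := hg
    exact Functor.isEquivalence_trans f.toFunctor g.toFunctor
  of_postcomp f g hg hfg := by
    have : g.toFunctor.IsEquivalence := hg
    have : (f.toFunctor ⋙ g.toFunctor).IsEquivalence := hfg
    exact Functor.isEquivalence_of_comp_right f.toFunctor g.toFunctor
  of_precomp f g hf hfg := by
    have : f.toFunctor.IsEquivalence := hf
    have : (f.toFunctor ⋙ g.toFunctor).IsEquivalence := hfg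
    exact Functor.isEquivalence_of_comp_left f.toFunctor g.toFunctor

instance (N : C ⥤ SimplexCategoryᵒᵖ ⥤ Cat.{u, u}) :
    (levelwiseEquivalences N).HasTwoOutOfThreeProperty where
  comp_mem f g hf hg n := by
    rw [N.map_comp, NatTrans.comp_app]
    exact catEquivalences.comp_mem _ _ (hf n) (hg n)
  of_postcomp f g hg hfg n := by
    have := hfg n
    rw [N.map_comp, NatTrans.comp_app] at this
    exact catEquivalences.of_postcomp _ _ (hg n) this
  of_precomp f g hf hfg n := by
    have := hfg n
    rw [N.map_comp, NatTrans.comp_app] at this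
    exact catEquivalences.of_precomp _ _ (hf n) this

variable (N : C ⥤ SimplexCategoryᵒᵖ ⥤ Cat.{u, u})

/-- The free isomorphism retracts onto its point, so constant lifts exist; this makes every object
fibrant. -/
theorem isofibration_of_isTerminal {X T : Cat.{u, u}} (hT : IsTerminal T) (p : X ⟶ T) :
    catIsofibrations p := by
  refine (hasLiftingProperty_pointToIso_iff p).1 ⟨fun {t s} sq => ⟨⟨?_⟩⟩⟩
  exact ⟨((Functor.const _).obj (AsSmall.up.obj ⟨()⟩) :
    walkingIso.{u} ⥤ AsSmall.{u} (Discrete Unit)).toCatHom ≫ t, catHom_ext_of_point rfl,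
    hT.hom_ext _ _⟩

/-- An object sent by `N` to the levelwise category of isomorphisms in `N.obj B`. -/
structure LevelwisePath (B : C) where
  P : C
  iso : N.obj P ≅ N.obj B ⋙ catPath

namespace LevelwisePath

variable {N} [N.Full] {B : C} (P : LevelwisePath N B)

/-- The evaluation at an endpoint. -/
noncomputable def ev (i : walkingIso.{u}) : P.P ⟶ B :=
  N.preimage (P.iso.hom ≫ Functor.whiskerLeft (N.obj B) (catPath.ev i))

/-- The constant paths. -/
noncomputable def const : B ⟶ P.P :=
  N.preimage (Functor.whiskerLeft (N.obj B) catPath.const ≫ P.iso.inv)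

theorem map_ev_app (i : walkingIso.{u}) (n : SimplexCategoryᵒᵖ) :
    (N.map (P.ev i)).app n = P.iso.hom.app n ≫ (catPath.ev i).app _ := by
  simp [ev]

theorem const_ev [N.Faithful] (i : walkingIso.{u}) : P.const ≫ P.ev i = 𝟙 B := by
  apply N.map_injective
  rw [const, ev, N.map_comp, N.map_preimage, N.map_preimage, Category.assoc, Iso.inv_hom_id_assoc,
    N.map_id]
  rfl

/-- `N` preserves `B ⨯ B`, so the lift can be found componentwise in `Cat` and transported along
`P.iso`. -/
theorem lift_ev_isofibration [HasBinaryProducts C] [PreservesLimitsOfShape (Discrete WalkingPair) N]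
    (n : SimplexCategoryᵒᵖ) : catIsofibrations ((N.map
      (prod.lift (P.ev walkingIso.zero) (P.ev walkingIso.one))).app n) := by
  refine (hasLiftingProperty_pointToIso_iff _).1 ⟨fun {t s} sq => ⟨?_⟩⟩
  have hfst : (N.map (prod.lift (P.ev walkingIso.zero) (P.ev walkingIso.one))).app n ≫
      (N.map prod.fst).app n = P.iso.hom.app n ≫ (catPath.ev walkingIso.zero).app _ := by
    rw [← NatTrans.comp_app, ← N.map_comp, prod.lift_fst, map_ev_app]
  have hsnd : (N.map (prod.lift (P.ev walkingIso.zero) (P.ev walkingIso.one))).app n ≫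
      (N.map prod.snd).app n = P.iso.hom.app n ≫ (catPath.ev walkingIso.one).app _ := by
    rw [← NatTrans.comp_app, ← N.map_comp, prod.lift_snd, map_ev_app]
  have hext {Z : Cat.{u, u}} (f g : Z ⟶ (N.obj (B ⨯ B)).obj n)
      (h₀ : f ≫ (N.map prod.fst).app n = g ≫ (N.map prod.fst).app n)
      (h₁ : f ≫ (N.map prod.snd).app n = g ≫ (N.map prod.snd).app n) : f = g :=
    BinaryFan.IsLimit.hom_ext (mapIsLimitOfPreservesOfIsLimit
      (N ⋙ (evaluation _ _).obj n) _ _ (prodIsProd B B)) h₀ h₁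
  obtain ⟨l, hl, hl₀, hl₁⟩ := catPath.exists_lift (t ≫ P.iso.hom.app n)
    (s ≫ (N.map prod.fst).app n) (s ≫ (N.map prod.snd).app n)
    (by rw [Category.assoc, ← hfst, sq.w_assoc]) (by rw [Category.assoc, ← hsnd, sq.w_assoc])
  refine ⟨⟨l ≫ P.iso.inv.app n, ?_, ?_⟩⟩
  · rw [reassoc_of% hl, Iso.hom_inv_id_app, Category.comp_id]
  · apply hext
    · rw [Category.assoc, Category.assoc, hfst, Iso.inv_hom_id_app_assoc, hl₀]
    · rw [Category.assoc, Category.assoc, hsnd, Iso.inv_hom_id_app_assoc, hl₁]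

end LevelwisePath

variable {L : (SimplexCategoryᵒᵖ ⥤ Cat.{u, u}) ⥤ C} (adj : L ⊣ N)

include adj

theorem genAcyclicCof_rlp_iff {X Y : C} (p : X ⟶ Y) :
    ((diagramGen catGenAcyclicCof).strictMap L).rlp p ↔
      ∀ n, catIsofibrations ((N.map p).app n) := by
  rw [strictMap_rlp_iff _ adj, diagramGen_rlp_iff, catGenAcyclicCof_rlp]

/-- The adjunctions `L ⊣ N` and free object ⊣ evaluation move the lifting problems into `Cat`, level
by level. -/
theorem genCof_rlp :
    ((diagramGen catGenCof).strictMap L).rlp =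
      ((diagramGen catGenAcyclicCof).strictMap L).rlp ⊓ levelwiseEquivalences N := by
  ext X Y p
  refine Iff.trans ?_ (and_congr_left' (genAcyclicCof_rlp_iff N adj p).symm)
  rw [strictMap_rlp_iff _ adj, diagramGen_rlp_iff, catGenCof_rlp]
  exact forall_and

/-- Lifting `j` against `A → 1` gives a retraction, and lifting it against the path fibration of `B`
gives a homotopy from the identity to retraction followed by `j`. Applying `N` yields a
quasi-inverse in each degree. -/
theorem llp_rlp_le_levelwiseEquivalences [N.Full] [N.Faithful] [HasFiniteProducts C]
    (hN : ∀ B, Nonempty (LevelwisePath N B)) :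
    ((diagramGen catGenAcyclicCof).strictMap L).rlp.llp ≤ levelwiseEquivalences N := by
  intro A B j hj n
  have := adj.rightAdjoint_preservesLimits
  have hA : ((diagramGen catGenAcyclicCof).strictMap L).rlp (terminal.from A) :=
    (genAcyclicCof_rlp_iff N adj _).2 fun n => isofibration_of_isTerminal
      (IsTerminal.isTerminalObj (N ⋙ (evaluation _ _).obj n) _ terminalIsTerminal) _
  obtain ⟨P⟩ := hN B
  have hP : ((diagramGen catGenAcyclicCof).strictMap L).rlp
      (prod.lift (P.ev walkingIso.zero) (P.ev walkingIso.one)) :=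
    (genAcyclicCof_rlp_iff N adj _).2 P.lift_ev_isofibration
  have := hj _ hA
  have := hj _ hP
  have sq : CommSq (𝟙 A) j (terminal.from A) (terminal.from B) := ⟨by simp⟩
  -- The top is the constant path on `j`; the square commutes because `sq.lift` retracts `j`.
  have sq' : CommSq (j ≫ P.const) j (prod.lift (P.ev walkingIso.zero) (P.ev walkingIso.one))
      (prod.lift (𝟙 B) (sq.lift ≫ j)) := ⟨by
    rw [prod.comp_lift, prod.comp_lift, Category.assoc, Category.assoc, P.const_ev, P.const_ev,
      sq.fac_left_assoc, Category.comp_id, Category.id_comp]⟩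
  have h₀ : sq'.lift ≫ P.ev walkingIso.zero = 𝟙 B := by
    have h := sq'.fac_right =≫ prod.fst
    rwa [Category.assoc, prod.lift_fst, prod.lift_fst] at h
  have h₁ : sq'.lift ≫ P.ev walkingIso.one = sq.lift ≫ j := by
    have h := sq'.fac_right =≫ prod.snd
    rwa [Category.assoc, prod.lift_snd, prod.lift_snd] at h
  refine catPath.isEquivalence_of_homotopy _ ((N.map sq.lift).app n) ?_
    ((N.map sq'.lift).app n ≫ P.iso.hom.app n) ?_ ?_
  · rw [← NatTrans.comp_app, ← N.map_comp, sq.fac_left, N.map_id, NatTrans.id_app]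
  · rw [Category.assoc, ← P.map_ev_app, ← NatTrans.comp_app, ← N.map_comp, h₀, N.map_id,
      NatTrans.id_app]
  · rw [Category.assoc, ← P.map_ev_app, ← NatTrans.comp_app, ← N.map_comp, h₁, N.map_comp,
      NatTrans.comp_app]

theorem exists_transferred_modelCategory [N.Full] [N.Faithful] [LocallySmall.{u} C]
    [IsLocallyPresentable.{u} C] [HasLimitsOfSize.{u, u} C] [HasColimitsOfSize.{u, u} C]
    (hN : ∀ B, Nonempty (LevelwisePath N B)) :
    ∃ _ : ModelCategory C,
      (∀ {X Y : C} (f : X ⟶ Y), WeakEquivalence f ↔ ∀ n, catEquivalences ((N.map f).app n)) ∧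
      (∀ {X Y : C} (f : X ⟶ Y), Fibration f ↔ ∀ n, catIsofibrations ((N.map f).app n)) ∧
      IsCofibrantlyGeneratedBy.{u} C ((diagramGen catGenCof).strictMap L)
        ((diagramGen catGenAcyclicCof).strictMap L) := by
  have := isSmall_diagramGen catGenCof.{u}
  have := isSmall_diagramGen catGenAcyclicCof.{u}
  have := isSmall_strictMap (diagramGen catGenCof.{u}) L
  have := isSmall_strictMap (diagramGen catGenAcyclicCof.{u}) L
  have : HasFiniteLimits C := hasFiniteLimits_of_hasLimitsOfSize.{u, u} C
  obtain ⟨_, hW, hF, h⟩ := exists_modelCategory.{u} _ _ _ (genCof_rlp N adj)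
    (llp_rlp_le_levelwiseEquivalences N adj hN)
  refine ⟨inferInstance, fun f => ?_, fun f => ?_, h⟩
  · rw [weakEquivalence_iff, hW]
    rfl
  · rw [fibration_iff, hF, genAcyclicCof_rlp_iff N adj]

end Transfer

/-! ### The model structures -/

instance : IsLocallyPresentable.{u} (SimplexCategoryᵒᵖ ⥤ Cat.{u, u}) := by
  obtain ⟨κ, _, _⟩ := IsLocallyPresentable.exists_cardinal.{u} Cat.{u, u}
  exact ⟨κ, inferInstance, isCardinalLocallyPresentable_simplicial _ κ⟩

theorem nonempty_levelwisePath_horizontalNerve (D : DblCat.{u}) :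
    Nonempty (LevelwisePath horizontalNerve.{u} D) :=
  have h := isSegal_comp (isSegal_horizontalNerve D) catPath.{u}
  ⟨DblCat.ofSegal h, (asIso (DblCat.toNerve h)).symm⟩

theorem mainTheorem2 :
    ∃ (_ : ModelCategory (SimplexCategoryᵒᵖ ⥤ Cat.{u, u}))
      (c_h : (SimplexCategoryᵒᵖ ⥤ Cat.{u, u}) ⥤ DblCat.{u})
      (_ : c_h ⊣ horizontalNerve.{u})
      (_ : ModelCategory DblCat.{u}),
      -- the diagram categorical structure on `Cat^{Δ^op}`
      (∀ {X Y : SimplexCategoryᵒᵖ ⥤ Cat.{u, u}} (α : X ⟶ Y),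
        WeakEquivalence α ↔ ∀ n, catEquivalences (α.app n)) ∧
      (∀ {X Y : SimplexCategoryᵒᵖ ⥤ Cat.{u, u}} (α : X ⟶ Y),
        Fibration α ↔ ∀ n, catIsofibrations (α.app n)) ∧
      IsCofibrantlyGeneratedBy.{u} (SimplexCategoryᵒᵖ ⥤ Cat.{u, u})
        (diagramGen catGenCof) (diagramGen catGenAcyclicCof) ∧
      -- the transferred structure on `DblCat`
      (∀ {D E : DblCat.{u}} (K : D ⟶ E),
        WeakEquivalence K ↔ ∀ n, catEquivalences ((horizontalNerve.map K).app n)) ∧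
      (∀ {D E : DblCat.{u}} (K : D ⟶ E),
        Fibration K ↔ ∀ n, catIsofibrations ((horizontalNerve.map K).app n)) ∧
      (∀ {D E : DblCat.{u}} (K : D ⟶ E),
        WeakEquivalence K ↔ WeakEquivalence (horizontalNerve.map K)) ∧
      (∀ {D E : DblCat.{u}} (K : D ⟶ E),
        Fibration K ↔ Fibration (horizontalNerve.map K)) ∧
      IsCofibrantlyGeneratedBy.{u} DblCat.{u}
        ((diagramGen catGenCof).strictMap c_h) ((diagramGen catGenAcyclicCof).strictMap c_h) := by
  obtain ⟨_, _⟩ := horizontalNerve_isRightAdjoint_and_presentable.{u}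
  let adj := Adjunction.ofIsRightAdjoint horizontalNerve.{u}
  have : Reflective horizontalNerve.{u} := ⟨_, adj⟩
  have : HasLimits DblCat.{u} := hasLimits_of_reflective horizontalNerve.{u}
  have : HasColimits DblCat.{u} := hasColimits_of_reflective horizontalNerve.{u}
  -- For the identity functor the levelwise path object needs no representability argument.
  obtain ⟨m₁, hW₁, hF₁, h₁⟩ := exists_transferred_modelCategory
    (𝟭 (SimplexCategoryᵒᵖ ⥤ Cat.{u, u})) Adjunction.id fun X => ⟨⟨X ⋙ catPath, Iso.refl _⟩⟩
  obtain ⟨m₂, hW₂, hF₂, h₂⟩ := exists_transferred_modelCategory horizontalNerve.{u} adj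
    nonempty_levelwisePath_horizontalNerve
  rw [MorphismProperty.strictMap_id, MorphismProperty.strictMap_id] at h₁
  exact ⟨m₁, _, adj, m₂, hW₁, hF₁, h₁, hW₂, hF₂, fun K => (hW₂ K).trans (hW₁ _).symm,
    fun K => (hF₂ K).trans (hF₁ _).symm, h₂⟩
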